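/- **Conventions.** Hilbert spaces are complex, of arbitrary dimension, and $n\ge 1$. For a Hilbert space $\mathcal E$, $H^2_{\mathcal E}(\mathbb D)$ is the Hilbert space of functions $f(z)=\sum_{k\ge 0} z^k a_k$ on the open unit disc $\mathbb D$ with $a_k\in\mathcal E$ and $\|f\|^2=\sum_k\|a_k\|^2<\infty$. $H^\infty_{\mathcal B(\mathcal E,\mathcal F)}(\mathbb D)$ is the set of bounded holomorphic functions $\mathbb D\to\mathcal B(\mathcal E,\mathcal F)$. Such a function $\Theta$ acts by $(M_\Theta f)(z)=\Theta(z)f(z)$, and it is *inner* if $M_\Theta:H^2_{\mathcal E}(\mathbb D)\to H^2_{\mathcal F}(\mathbb D)$ is an isometry. We write $\Theta H^2_{\mathcal E}(\mathbb D)=\{M_\Theta f: f\in H^2_{\mathcal E}(\mathbb D)\}$. A tuple $(M_{\Phi_1},\dots,M_{\Phi_n})$ on $H^2_{\mathcal E}(\mathbb D)$ is a *model $n$-isometry* if there are unitary operators $U_1,\dots,U_n$ and orthogonal projections $P_1,\dots,P_n$ on $\mathcal E$ with $\Phi_i(z)=U_i(P_i^\perp+zP_i)$ for all $z\in\mathbb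 D$, where $P_i^\perp=I_{\mathcal E}-P_i$, such that (a) $U_iU_j=U_jU_i$ for all $i,j$; (b) $U_1\cdots U_n=I_{\mathcal E}$; (c) $P_i+U_i^*P_jU_i=P_j+U_j^*P_iU_j\le I_{\mathcal E}$ for all $i\ne j$; (d) $P_1+U_1^*P_2U_1+U_1^*U_2^*P_3U_2U_1+\cdots+U_1^*\cdots U_{n-1}^*P_nU_{n-1}\cdots U_1=I_{\mathcal E}$. **Theorem 4.1.** Let $\mathcal W$ be a Hilbert space, let $(M_{\Phi_1},\dots,M_{\Phi_n})$ be a model $n$-isometry on $H^2_{\mathcal W}(\mathbb D)$, and let $\mathcal S$ be a closed subspace of $H^2_{\mathcal W}(\mathbb D)$. Then $M_{\Phi_j}\mathcal S\subseteq\mathcal S$ for all $j=1,\dots,n$ if and only if there exist a Hilbert space $\mathcal W_*$, an inner function $\Theta\in H^\infty_{\mathcal B(\mathcal W_*,\mathcal W)}(\mathbb D)$ and a model $n$-isometry $(M_{\Psi_1},\dots,M_{\Psi_n})$ on $H^2_{\mathcal W_*}(\mathbb D)$ such that $$\mathcal S=\Theta H^2_{\mathcal W_*}(\mathbb D)\quad\text{and}\quad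 \Phi_j\Theta=\Theta\Psi_j\ \text{ on } \mathbb D \text{ for all } j=1,\dots,n.$$ Moreover, the representation is unique up to a unitary: if $(\mathcal W_*,\Theta,\Psi_1,\dots,\Psi_n)$ and $(\hat{\mathcal W},\hat\Theta,\hat\Psi_1,\dots,\hat\Psi_n)$ are two such representations of the same $\mathcal S$, then there is a unitary $\tau:\mathcal W_*\to\hat{\mathcal W}$ such that $\Theta(z)=\hat\Theta(z)\tau$ and $\hat\Psi_j(z)\tau=\tau\Psi_j(z)$ for all $z\in\mathbb D$ and $j=1,\dots,n$. -/

import Mathlib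

open scoped Complex.UnitDisc ENNReal

universe u v w

noncomputable section

namespace HardyModel

section HardySpace

variable (E : Type*) [NormedAddCommGroup E] [InnerProductSpace ℂ E]

/-- A power series with square-summable coefficients converges on the open unit disc. -/
theorem summable_pow_smul {E : Type*} [NormedAddCommGroup E] [InnerProductSpace ℂ E]
    [CompleteSpace E] (a : lp (fun _ : ℕ => E) 2) (z : 𝔻) :
    Summable fun k : ℕ => (z : ℂ) ^ k • a k := by
  refine Summable.of_norm_bounded (g := fun k => ‖(z : ℂ)‖ ^ k * ‖a‖)
    ((summable_geometric_of_lt_one (norm_nonneg _) z.norm_lt_one).mul_right _) fun k => ?_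
  rw [norm_smul, norm_pow]
  exact mul_le_mul_of_nonneg_left (lp.norm_apply_le_norm two_ne_zero a k) (by positivity)

variable [CompleteSpace E]

/-- The linear map sending a square-summable sequence `a` to the function `z ↦ ∑ zᵏ aₖ`
on the open unit disc. -/
def powerSeriesMap : lp (fun _ : ℕ => E) 2 →ₗ[ℂ] (𝔻 → E) where
  toFun a z := ∑' k : ℕ, (z : ℂ) ^ k • a k
  map_add' a b := by
    funext z
    simp only [lp.coeFn_add, Pi.add_apply, smul_add]
    exact (summable_pow_smul a z).tsum_add (summable_pow_smul b z)
  map_smul' c a := by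
    funext z
    simp only [lp.coeFn_smul, Pi.smul_apply, RingHom.id_apply]
    rw [← (summable_pow_smul a z).tsum_const_smul c]
    simp only [smul_comm c]

theorem powerSeriesMap_injective : Function.Injective (powerSeriesMap E) := by
  rw [← LinearMap.ker_eq_bot, LinearMap.ker_eq_bot']
  intro a ha
  let p : FormalMultilinearSeries ℂ ℂ E := fun k => ContinuousMultilinearMap.mkPiRing ℂ (Fin k) (a k)
  have hp : HasFPowerSeriesAt (fun _ : ℂ => (0 : E)) p 0 := by
    rw [hasFPowerSeriesAt_iff]
    filter_upwards [Metric.ball_mem_nhds (0 : ℂ) one_pos] with z hz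
    rw [mem_ball_zero_iff] at hz
    have h := (summable_pow_smul a (Complex.UnitDisc.mk z hz)).hasSum
    have h0 : ∑' k : ℕ, ((Complex.UnitDisc.mk z hz : 𝔻) : ℂ) ^ k • a k = 0 :=
      congrFun ha (Complex.UnitDisc.mk z hz)
    rw [h0] at h
    simpa [p, FormalMultilinearSeries.coeff] using h
  have h0 : p = 0 := hp.eq_zero
  ext k
  have hk : p.coeff k = 0 := by rw [h0]; rfl
  simpa [p, FormalMultilinearSeries.coeff] using hk

/-- The `E`-valued Hardy space `H²_E(𝔻)`: the space of all functions `f : 𝔻 → E` of the form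
`f z = ∑ zᵏ aₖ` with `∑ ‖aₖ‖² < ∞`. -/
def HardySpace : Type _ := LinearMap.range (powerSeriesMap E)

namespace HardySpace

instance : FunLike (HardySpace E) 𝔻 E where
  coe f := f.1
  coe_injective := Subtype.val_injective

instance : AddCommGroup (HardySpace E) :=
  inferInstanceAs (AddCommGroup (LinearMap.range (powerSeriesMap E)))

instance : Module ℂ (HardySpace E) :=
  inferInstanceAs (Module ℂ (LinearMap.range (powerSeriesMap E)))

/-- A function in the Hardy space corresponds to its sequence of Taylor coefficients. -/
def coeffs : HardySpace E ≃ₗ[ℂ] lp (fun _ : ℕ => E) 2 :=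
  (LinearEquiv.ofInjective (powerSeriesMap E) (powerSeriesMap_injective E)).symm

/-- The norm of `H²_E(𝔻)` is the `ℓ²` norm of the sequence of Taylor coefficients. -/
instance : NormedAddCommGroup (HardySpace E) :=
  NormedAddCommGroup.induced (HardySpace E) (lp (fun _ : ℕ => E) 2) (coeffs E)
    (coeffs E).injective

/-- The inner product of `H²_E(𝔻)` is `⟪∑ zᵏ aₖ, ∑ zᵏ bₖ⟫ = ∑ ⟪aₖ, bₖ⟫`. -/
instance : InnerProductSpace ℂ (HardySpace E) where
  norm_smul_le c f := by
    change ‖coeffs E (c • f)‖ ≤ ‖c‖ * ‖coeffs E f‖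
    rw [map_smul, norm_smul]
  inner f g := inner ℂ (coeffs E f) (coeffs E g)
  norm_sq_eq_re_inner f := norm_sq_eq_re_inner (𝕜 := ℂ) (coeffs E f)
  conj_inner_symm f g := inner_conj_symm (𝕜 := ℂ) (coeffs E f) (coeffs E g)
  add_left f g h := by rw [map_add, inner_add_left]
  smul_left f g c := by rw [map_smul, inner_smul_left]

/-- Passing to Taylor coefficients is a unitary operator from `H²_E(𝔻)` onto `ℓ²(ℕ, E)`. -/
def coeffsIsometry : HardySpace E ≃ₗᵢ[ℂ] lp (fun _ : ℕ => E) 2 where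
  toLinearEquiv := coeffs E
  norm_map' _ := rfl

instance : CompleteSpace (HardySpace E) :=
  (completeSpace_congr (e := (coeffsIsometry E).toEquiv)
    (coeffsIsometry E).isometry.isUniformEmbedding).2 inferInstance

theorem apply_eq_tsum (f : HardySpace E) (z : 𝔻) :
    f z = ∑' k : ℕ, (z : ℂ) ^ k • coeffsIsometry E f k := by
  have h : powerSeriesMap E ((LinearEquiv.ofInjective (powerSeriesMap E)
      (powerSeriesMap_injective E)).symm f) = f.1 :=
    congrArg Subtype.val ((LinearEquiv.ofInjective (powerSeriesMap E)
      (powerSeriesMap_injective E)).apply_symm_apply f)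
  exact (congrFun h z).symm

end HardySpace

end HardySpace

section Multipliers

variable {E F : Type*} [NormedAddCommGroup E] [InnerProductSpace ℂ E] [CompleteSpace E]
  [NormedAddCommGroup F] [InnerProductSpace ℂ F] [CompleteSpace F]

/-- `Θ` belongs to `H^∞_{B(E, F)}(𝔻)`: it is a bounded holomorphic operator-valued function on the
open unit disc. Functions on the disc are represented by functions on `ℂ`; only the values on the
disc matter. -/
def IsHInfty (Θ : ℂ → E →L[ℂ] F) : Prop :=
  DifferentiableOn ℂ Θ (Metric.ball 0 1) ∧ ∃ C : ℝ, ∀ z : 𝔻, ‖Θ z‖ ≤ C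

/-- `g = M_Θ f`, that is, `g z = Θ(z) f(z)` for all `z` in the disc. -/
def IsMul (Θ : ℂ → E →L[ℂ] F) (f : HardySpace E) (g : HardySpace F) : Prop :=
  ∀ z : 𝔻, g z = Θ z (f z)

/-- `Θ` is inner: it is a bounded holomorphic function and multiplication by `Θ` is an isometry
`M_Θ : H²_E(𝔻) → H²_F(𝔻)`. -/
def IsInner (Θ : ℂ → E →L[ℂ] F) : Prop :=
  IsHInfty Θ ∧ ∃ M : HardySpace E →ₗᵢ[ℂ] HardySpace F, ∀ f, IsMul Θ f (M f)

/-- The set `Θ H²_E(𝔻) = {Θ f : f ∈ H²_E(𝔻)}`. -/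
def mulRange (Θ : ℂ → E →L[ℂ] F) : Set (HardySpace F) :=
  {g | ∃ f : HardySpace E, IsMul Θ f g}

/-- The subspace `S` is jointly invariant under the multiplication operators
`M_{Φ 0}, …, M_{Φ (n - 1)}`: for `f ∈ S`, every product `Φ j f` is again an element of `S`. -/
def IsJointlyInvariant {n : ℕ} (Φ : Fin n → ℂ → E →L[ℂ] E) (S : Submodule ℂ (HardySpace E)) :
    Prop :=
  ∀ j, ∀ f ∈ S, ∃ g ∈ S, IsMul (Φ j) f g

/-- The product `U_{j-1} ⋯ U_1 U_0` (the empty product, `1`, for `j = 0`). -/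
def descProd {n : ℕ} (U : Fin n → E →L[ℂ] E) (j : ℕ) : E →L[ℂ] E :=
  ((List.ofFn U).take j).reverse.prod

/-- The tuple `(M_{Φ 0}, …, M_{Φ (n - 1)})` is a model `n`-isometry on `H²_E(𝔻)`: there are unitary
operators `U i` and orthogonal projections `P i` on `E` with `Φ i z = U i ((P i)^⊥ + z P i)` on the
disc and such that the four conditions of Bercovici, Douglas and Foias hold. -/
def IsModelNIsometry {n : ℕ} (Φ : Fin n → ℂ → E →L[ℂ] E) : Prop :=
  ∃ U P : Fin n → E →L[ℂ] E,
    (∀ i, U i ∈ unitary (E →L[ℂ] E)) ∧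
    (∀ i, IsStarProjection (P i)) ∧
    (∀ i, ∀ z : 𝔻, Φ i z = U i * ((1 - P i) + (z : ℂ) • P i)) ∧
    (∀ i j, U i * U j = U j * U i) ∧
    (List.ofFn U).prod = 1 ∧
    (∀ i j, i ≠ j →
      P i + star (U i) * P j * U i = P j + star (U j) * P i * U j ∧
      P i + star (U i) * P j * U i ≤ 1) ∧
    ∑ j : Fin n, star (descProd U j) * P j * descProd U j = 1

/-- A representation of `S` over the space `E`: an inner function `Θ` and a model `n`-isometry
`(M_{Ψ j})` on `H²_E(𝔻)` with `S = Θ H²_E(𝔻)` and `Φ j Θ = Θ Ψ j` on the disc for all `j`. -/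
def IsRepresentation {n : ℕ} (Φ : Fin n → ℂ → F →L[ℂ] F) (S : Submodule ℂ (HardySpace F))
    (Θ : ℂ → E →L[ℂ] F) (Ψ : Fin n → ℂ → E →L[ℂ] E) : Prop :=
  IsInner Θ ∧ IsModelNIsometry Ψ ∧ (S : Set (HardySpace F)) = mulRange Θ ∧
    ∀ j, ∀ z : 𝔻, Φ j z ∘L Θ z = Θ z ∘L Ψ j z

end Multipliers

end HardyModel

end

/-!
The argument follows Beurling, Lax and Halmos, combined with the Berger–Coburn–Lebow description of
commuting isometries whose product is a shift.

A model tuple acts on the Hardy space by commuting isometries with product `M_z`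
(`IsModelNIsometry.exists_operators`). After the unitary parts are moved to the left, the product of
the pencils `U (P^⊥ + z P)` has factors `1 + (z - 1) R` for projections `R` that add up to the
identity; these are therefore mutually orthogonal and the product is
`1 + (z - 1) ∑ R = z` (`descProd_pencil`).

If `S` is invariant, then `M_z` restricts to a pure isometry `T` of `S`. By the Wold decomposition
`S` is the orthogonal sum of the spaces `Tᵏ L` with `L = (T S)ᗮ`, which says precisely that
multiplication by the evaluation `Θ(z) w = w(z)`, `w ∈ L`, is an isometry of the Hardy space of `L`
onto `S` (`exists_isMul_wanderingSymbol`). The bound `‖Θ(z)‖ ≤ 1` comes from the Szegő kernel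
(`norm_symbol_le_one`).

Let `X` be the restriction to `S` of one of the given isometries and `Y` the product of the others,
so that `T = X Y = Y X`. On `L` we have `X = A + T B`, where `A` is the compression of `X` to `L`
and `B` the restriction of `Y*` (`apply_eq_compress_add`). Consequently `Φ Θ = Θ (A + z B)`. The
relations between `A` and `B` in `compress_relations`, together with those obtained by exchanging
`X` and `Y`, mean that `A + z B = U (P^⊥ + z P)` for the unitary `U = A + B` and the projection
`P = B* B` (`pencil_of_relations`). The new pencils commute and have product `z`, because `Θ` can
be cancelled. The conditions defining a model tuple are read off from these polynomial identities
in `isModelNIsometry_pencil`: the values at `1` give the relations between the unitaries, the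
derivative of the product at `1` gives the sum of the projections, and the commutation of two
pencils gives the relation between two projections. The inequality needs in addition that products
of two different coefficients `B` vanish (`compress_star_mul_compress_star`).

For uniqueness, two inner functions with the same range induce a unitary operator between the two
Hardy spaces that commutes with `M_z`; it preserves the orthogonal complement of the range of `M_z`,
that is, the constants, and hence is given by a constant unitary
(`exists_unitary_of_mulRange_eq`).
-/

namespace HardyModel

/-! ### Taylor coefficients of functions in the Hardy space -/

namespace HardySpace

variable {E F : Type*} [NormedAddCommGroup E] [InnerProductSpace ℂ E] [CompleteSpace E]
  [NormedAddCommGroup F] [InnerProductSpace ℂ F] [CompleteSpace F]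

variable (E) in
/-- The `k`-th Taylor coefficient, as a bounded operator on the Hardy space. -/
noncomputable def coeff (k : ℕ) : HardySpace E →L[ℂ] E :=
  lp.evalCLM ℂ (fun _ : ℕ => E) 2 k ∘L
    ((coeffsIsometry E).toContinuousLinearEquiv : HardySpace E →L[ℂ] lp (fun _ : ℕ => E) 2)

theorem coeff_apply (k : ℕ) (f : HardySpace E) : coeff E k f = coeffsIsometry E f k := rfl

theorem ext_coeff {f g : HardySpace E} (h : ∀ k, coeff E k f = coeff E k g) : f = g :=
  (coeffsIsometry E).injective (lp.ext (funext h))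

theorem norm_coeff_le (k : ℕ) : ‖coeff E k‖ ≤ 1 :=
  ContinuousLinearMap.opNorm_le_bound _ zero_le_one fun f => by
    rw [one_mul, coeff_apply, ← (coeffsIsometry E).norm_map f]
    exact lp.norm_apply_le_norm two_ne_zero _ k

theorem hasSum_inner_coeff (f g : HardySpace E) :
    HasSum (fun k => inner ℂ (coeff E k f) (coeff E k g)) (inner ℂ f g) :=
  lp.hasSum_inner (coeffsIsometry E f) (coeffsIsometry E g)

theorem hasSum_norm_coeff_sq (f : HardySpace E) :
    HasSum (fun k => ‖coeff E k f‖ ^ 2) (‖f‖ ^ 2) := by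
  have h := lp.hasSum_norm (p := 2) (by norm_num) (coeffsIsometry E f)
  rw [(coeffsIsometry E).norm_map] at h
  simpa [coeff_apply] using h

theorem hasSum_apply (f : HardySpace E) (z : 𝔻) :
    HasSum (fun k : ℕ => (z : ℂ) ^ k • coeff E k f) (f z) := by
  rw [apply_eq_tsum]
  exact (summable_pow_smul _ z).hasSum

/-- The function with a prescribed square-summable sequence of Taylor coefficients. -/
noncomputable def ofSeq (a : ℕ → E) (ha : Summable fun k => ‖a k‖ ^ 2) : HardySpace E :=
  (coeffsIsometry E).symm ⟨a, memℓp_gen (by simpa using ha)⟩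

@[simp]
theorem coeff_ofSeq (a : ℕ → E) (ha : Summable fun k => ‖a k‖ ^ 2) (k : ℕ) :
    coeff E k (ofSeq a ha) = a k := by
  rw [coeff_apply, ofSeq, LinearIsometryEquiv.apply_symm_apply]

@[simp]
theorem add_apply (f g : HardySpace E) (z : 𝔻) : (f + g) z = f z + g z := rfl

@[simp]
theorem smul_apply (c : ℂ) (f : HardySpace E) (z : 𝔻) : (c • f) z = c • f z := rfl

/-! ### Constants, coefficientwise operators and the unilateral shift -/

theorem summable_norm_map_coeff_sq {G : Type*} [NormedAddCommGroup G] [InnerProductSpace ℂ G]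
    (A : E →L[ℂ] G) (f : HardySpace E) :
    Summable fun k => ‖A (coeff E k f)‖ ^ 2 := by
  refine Summable.of_nonneg_of_le (fun _ => by positivity) (fun k => ?_)
    ((hasSum_norm_coeff_sq f).summable.mul_left (‖A‖ ^ 2))
  rw [← mul_pow]
  exact pow_le_pow_left₀ (norm_nonneg _) (A.le_opNorm _) 2

/-- The operator `f ↦ A f` given by applying `A` to all coefficients. -/
noncomputable def diag (A : E →L[ℂ] F) : HardySpace E →L[ℂ] HardySpace F :=
  LinearMap.mkContinuous
    { toFun := fun f => ofSeq _ (summable_norm_map_coeff_sq A f)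
      map_add' := fun f g => ext_coeff fun k => by simp
      map_smul' := fun c f => ext_coeff fun k => by simp }
    ‖A‖ fun f => by
      refine le_of_sq_le_sq ?_ (by positivity)
      rw [mul_pow]
      refine hasSum_le (fun k => ?_) (hasSum_norm_coeff_sq _)
        ((hasSum_norm_coeff_sq f).mul_left (‖A‖ ^ 2))
      rw [← mul_pow]
      simpa using pow_le_pow_left₀ (norm_nonneg _) (A.le_opNorm (coeff E k f)) 2

@[simp]
theorem coeff_diag (A : E →L[ℂ] F) (f : HardySpace E) (k : ℕ) :
    coeff F k (diag A f) = A (coeff E k f) :=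
  coeff_ofSeq _ (summable_norm_map_coeff_sq A f) k

@[simp]
theorem diag_apply (A : E →L[ℂ] F) (f : HardySpace E) (z : 𝔻) : diag A f z = A (f z) := by
  refine (hasSum_apply (diag A f) z).unique ?_
  simpa using A.hasSum (hasSum_apply f z)

/-- The sequence `a` moved one place to the right, with `0` in front. -/
def shiftSeq (a : ℕ → E) : ℕ → E
  | 0 => 0
  | k + 1 => a k

theorem hasSum_norm_shiftSeq_sq (f : HardySpace E) :
    HasSum (fun k => ‖shiftSeq (fun m => coeff E m f) k‖ ^ 2) (‖f‖ ^ 2) := by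
  refine (hasSum_nat_add_iff' 1).1 ?_
  simpa [shiftSeq] using hasSum_norm_coeff_sq f

variable (E) in
/-- The operator `M_z` of multiplication by the coordinate function. -/
noncomputable def shift : HardySpace E →ₗᵢ[ℂ] HardySpace E where
  toFun f := ofSeq _ (hasSum_norm_shiftSeq_sq f).summable
  map_add' f g := ext_coeff fun k => by cases k <;> simp [shiftSeq]
  map_smul' c f := ext_coeff fun k => by cases k <;> simp [shiftSeq]
  norm_map' f := by
    refine (sq_eq_sq₀ (norm_nonneg _) (norm_nonneg _)).1 ?_
    refine (hasSum_norm_coeff_sq _).unique ?_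
    simpa using hasSum_norm_shiftSeq_sq f

@[simp]
theorem coeff_zero_shift (f : HardySpace E) : coeff E 0 (shift E f) = 0 :=
  coeff_ofSeq _ (hasSum_norm_shiftSeq_sq f).summable 0

@[simp]
theorem coeff_succ_shift (f : HardySpace E) (k : ℕ) :
    coeff E (k + 1) (shift E f) = coeff E k f :=
  coeff_ofSeq _ (hasSum_norm_shiftSeq_sq f).summable (k + 1)

@[simp]
theorem shift_apply (f : HardySpace E) (z : 𝔻) : shift E f z = (z : ℂ) • f z := by
  refine (hasSum_apply (shift E f) z).unique ((hasSum_nat_add_iff' 1).1 ?_)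
  simpa [pow_succ', mul_smul] using (hasSum_apply f z).const_smul (z : ℂ)

theorem coeff_iterate_shift_of_lt (f : HardySpace E) {j k : ℕ} (h : j < k) :
    coeff E j ((shift E)^[k] f) = 0 := by
  induction k generalizing j with
  | zero => omega
  | succ k ih =>
    rw [Function.iterate_succ_apply']
    cases j with
    | zero => simp
    | succ j => rw [coeff_succ_shift, ih (by omega)]

variable (E) in
/-- The embedding of `E` into the Hardy space as the constant functions. -/
noncomputable def const : E →ₗᵢ[ℂ] HardySpace E where
  toFun x := ofSeq (Pi.single 0 x) (summable_of_ne_finset_zero (s := {0}) fun k hk => by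
    rw [Pi.single_eq_of_ne (by simpa using hk)]; simp)
  map_add' x y := ext_coeff fun k => by simp [Pi.single_add]
  map_smul' c x := ext_coeff fun k => by simp [Pi.single_smul]
  norm_map' x := by
    refine (sq_eq_sq₀ (norm_nonneg _) (norm_nonneg _)).1 ?_
    refine (hasSum_norm_coeff_sq _).unique ?_
    have h := hasSum_single (f := fun k : ℕ => ‖(Pi.single 0 x : ℕ → E) k‖ ^ 2) 0 fun k hk => by
      rw [Pi.single_eq_of_ne hk]; simp
    simpa using h

@[simp]
theorem coeff_zero_const (x : E) : coeff E 0 (const E x) = x := by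
  simp [const]

@[simp]
theorem coeff_succ_const (x : E) (k : ℕ) : coeff E (k + 1) (const E x) = 0 := by
  simp [const]

@[simp]
theorem const_apply (x : E) (z : 𝔻) : const E x z = x := by
  refine (hasSum_apply (const E x) z).unique ?_
  have h := hasSum_single (f := fun k : ℕ => (z : ℂ) ^ k • coeff E k (const E x)) 0 fun k hk => by
    obtain ⟨m, rfl⟩ := Nat.exists_eq_succ_of_ne_zero hk
    simp
  simpa using h

theorem inner_const_shift (x : E) (f : HardySpace E) : inner ℂ (const E x) (shift E f) = 0 := by
  refine (hasSum_inner_coeff _ _).unique ?_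
  have h : (fun k => inner ℂ (coeff E k (const E x)) (coeff E k (shift E f))) = fun _ => 0 := by
    funext k
    cases k <;> simp
  rw [h]
  exact hasSum_zero

/-- Every function splits into its value at the origin and a multiple of the coordinate. -/
theorem exists_eq_const_add_shift (f : HardySpace E) :
    ∃ g, f = const E (coeff E 0 f) + shift E g :=
  ⟨ofSeq (fun k => coeff E (k + 1) f)
    ((summable_nat_add_iff 1).2 (hasSum_norm_coeff_sq f).summable),
    ext_coeff fun k => by cases k <;> simp⟩

/-- The constants are the orthogonal complement of the range of the shift. -/
theorem eq_const_of_forall_inner_shift_eq_zero {f : HardySpace E}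
    (h : ∀ g, inner ℂ f (shift E g) = 0) : f = const E (coeff E 0 f) := by
  obtain ⟨g, hg⟩ := exists_eq_const_add_shift f
  have h0 := h g
  rw [hg, inner_add_left, inner_const_shift, zero_add, inner_self_eq_zero] at h0
  rw [h0, add_zero] at hg
  exact hg

/-! ### Point evaluations -/

section PowerSeries

variable {X : Type*} [NormedAddCommGroup X] [NormedSpace ℂ X]

/-- The sum of the power series with coefficients `c k`. -/
noncomputable def powerSum (c : ℕ → X) (z : ℂ) : X := ∑' k : ℕ, z ^ k • c k

theorem hasSum_powerSum [CompleteSpace X] {c : ℕ → X} (hc : ∀ k, ‖c k‖ ≤ 1) (z : 𝔻) :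
    HasSum (fun k : ℕ => (z : ℂ) ^ k • c k) (powerSum c z) := by
  refine Summable.hasSum (.of_norm_bounded
    (summable_geometric_of_lt_one (norm_nonneg _) z.norm_lt_one) fun k => ?_)
  rw [norm_smul, norm_pow]
  exact mul_le_of_le_one_right (by positivity) (hc k)

theorem differentiableOn_powerSum [CompleteSpace X] {c : ℕ → X} (hc : ∀ k, ‖c k‖ ≤ 1) :
    DifferentiableOn ℂ (powerSum c) (Metric.ball 0 1) := by
  intro z hz
  rw [mem_ball_zero_iff] at hz
  obtain ⟨r, hzr, hr⟩ := exists_between hz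
  have h : DifferentiableOn ℂ (powerSum c) (Metric.ball 0 r) := by
    refine Complex.differentiableOn_tsum_of_summable_norm (u := fun k => r ^ k)
      (summable_geometric_of_lt_one ((norm_nonneg z).trans hzr.le) hr)
      (fun k => by fun_prop) Metric.isOpen_ball fun k w hw => ?_
    rw [mem_ball_zero_iff] at hw
    rw [norm_smul, norm_pow]
    exact (mul_le_of_le_one_right (by positivity) (hc k)).trans
      (pow_le_pow_left₀ (norm_nonneg _) hw.le k)
  exact (h.differentiableAt
    (Metric.isOpen_ball.mem_nhds (mem_ball_zero_iff.2 hzr))).differentiableWithinAt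

end PowerSeries

variable (E) in
/-- Evaluation at a point of the disc as a bounded operator, given by the Taylor series; outside the
disc the value is of no significance. -/
noncomputable def eval : ℂ → HardySpace E →L[ℂ] E := powerSum (coeff E)

theorem eval_apply (z : 𝔻) (f : HardySpace E) : eval E z f = f z :=
  ((hasSum_powerSum norm_coeff_le z).mapL (ContinuousLinearMap.apply ℂ E f)).unique
    (hasSum_apply f z)

theorem differentiableOn_eval : DifferentiableOn ℂ (eval E) (Metric.ball 0 1) :=
  differentiableOn_powerSum norm_coeff_le

/-- The squared norm `∑ |z|²ᵏ` of the scalar Szegő kernel at `z`. -/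
noncomputable def kernelConst (z : 𝔻) : ℝ := ∑' k : ℕ, (‖(z : ℂ)‖ ^ 2) ^ k

theorem hasSum_kernelConst (z : 𝔻) : HasSum (fun k : ℕ => (‖(z : ℂ)‖ ^ 2) ^ k) (kernelConst z) :=
  (summable_geometric_of_lt_one (by positivity) z.sq_norm_lt_one).hasSum

theorem kernelConst_pos (z : 𝔻) : 0 < kernelConst z := by
  rw [kernelConst, tsum_geometric_of_lt_one (by positivity) z.sq_norm_lt_one]
  exact inv_pos.2 (sub_pos.2 z.sq_norm_lt_one)

/-- The vector-valued Szegő kernel `∑ₖ z̄ᵏ wᵏ x`, a function of `w`. -/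
noncomputable def kernel (z : 𝔻) (x : E) : HardySpace E :=
  ofSeq (fun k => (starRingEnd ℂ (z : ℂ)) ^ k • x) (by
    simpa [norm_smul, mul_pow, pow_right_comm] using
      (hasSum_kernelConst z).summable.mul_right (‖x‖ ^ 2))

@[simp]
theorem coeff_kernel (z : 𝔻) (x : E) (k : ℕ) :
    coeff E k (kernel z x) = (starRingEnd ℂ (z : ℂ)) ^ k • x :=
  coeff_ofSeq _ _ k

theorem inner_kernel (z : 𝔻) (x : E) (f : HardySpace E) :
    inner ℂ (kernel z x) f = inner ℂ x (f z) := by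
  refine (hasSum_inner_coeff _ _).unique ?_
  simpa [inner_smul_left, inner_smul_right, mul_comm] using
    (hasSum_apply f z).mapL (innerSL ℂ x)

theorem norm_kernel_sq (z : 𝔻) (x : E) : ‖kernel z x‖ ^ 2 = kernelConst z * ‖x‖ ^ 2 := by
  refine (hasSum_norm_coeff_sq _).unique ?_
  simpa [norm_smul, mul_pow, pow_right_comm] using (hasSum_kernelConst z).mul_right (‖x‖ ^ 2)

theorem kernel_apply_self (z : 𝔻) (x : E) : kernel z x z = (kernelConst z : ℂ) • x := by
  refine (hasSum_apply _ z).unique ?_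
  have h := (Complex.hasSum_ofReal.2 (hasSum_kernelConst z)).smul_const x
  convert h using 2 with k
  rw [coeff_kernel, smul_smul, ← mul_pow, Complex.mul_conj, Complex.normSq_eq_norm_sq]
  push_cast
  rfl

end HardySpace

/-! ### Wold decomposition of a pure isometry -/

section Wold

variable {K : Type*} [NormedAddCommGroup K] [InnerProductSpace ℂ K]

/-- The wandering subspace `(T K)ᗮ` of an isometry `T`. -/
noncomputable def wandering (T : K →ₗᵢ[ℂ] K) : Submodule ℂ K := (LinearMap.range T.toLinearMap)ᗮ

instance [CompleteSpace K] (T : K →ₗᵢ[ℂ] K) : CompleteSpace (wandering T) :=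
  inferInstanceAs (CompleteSpace (LinearMap.range T.toLinearMap)ᗮ)

theorem mem_wandering_iff {T : K →ₗᵢ[ℂ] K} {x : K} :
    x ∈ wandering T ↔ ∀ y, inner ℂ (T y) x = 0 := by
  simp [wandering, Submodule.mem_orthogonal]

theorem eq_zero_of_mem_wandering {T : K →ₗᵢ[ℂ] K} {y : K} (h : T y ∈ wandering T) : y = 0 := by
  have h0 := mem_wandering_iff.1 h y
  rw [T.inner_map_map, inner_self_eq_zero] at h0
  exact h0

/-- The isometric embedding `x ↦ Tᵏ x` of the wandering subspace. -/
noncomputable def wanderingEmb (T : K →ₗᵢ[ℂ] K) (k : ℕ) : wandering T →ₗᵢ[ℂ] K :=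
  (T ^ k).comp (wandering T).subtypeₗᵢ

theorem wanderingEmb_succ (T : K →ₗᵢ[ℂ] K) (k : ℕ) (x : wandering T) :
    wanderingEmb T (k + 1) x = T (wanderingEmb T k x) := by
  simp [wanderingEmb, pow_succ']

theorem orthogonalFamily_wanderingEmb (T : K →ₗᵢ[ℂ] K) :
    OrthogonalFamily ℂ (fun _ : ℕ => wandering T) (wanderingEmb T) := by
  have key : ∀ j m (x y : wandering T),
      inner ℂ (wanderingEmb T (j + m + 1) x) (wanderingEmb T j y) = 0 := by
    intro j m x y
    induction j with
    | zero =>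
      rw [wanderingEmb_succ]
      exact mem_wandering_iff.1 y.2 _
    | succ j ih =>
      rw [show j + 1 + m + 1 = (j + m + 1) + 1 by omega, wanderingEmb_succ, wanderingEmb_succ T j,
        T.inner_map_map, ih]
  intro j k hjk x y
  rcases lt_or_gt_of_ne hjk with h | h
  · obtain ⟨m, rfl⟩ := Nat.exists_eq_add_of_lt h
    exact inner_eq_zero_symm.1 (key j m y x)
  · obtain ⟨m, rfl⟩ := Nat.exists_eq_add_of_lt h
    exact key k m x y

variable [CompleteSpace K]

/-- The orthogonal splitting `K = (T K)ᗮ ⊕ T K`. -/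
theorem exists_eq_wandering_add (T : K →ₗᵢ[ℂ] K) (x : K) :
    ∃ (w : wandering T) (y : K), x = w + T y := by
  have hc : IsComplete (LinearMap.range T.toLinearMap : Set K) := by
    rw [LinearMap.coe_range]
    exact T.isometry.isUniformInducing.isComplete_range
  have : CompleteSpace (LinearMap.range T.toLinearMap) := hc.completeSpace_coe
  obtain ⟨y, hy, z, hz, h⟩ :=
    (LinearMap.range T.toLinearMap).exists_add_mem_mem_orthogonal x
  obtain ⟨y', rfl⟩ := hy
  exact ⟨⟨z, hz⟩, y', by rw [h, add_comm]; rfl⟩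

/-- Wold: if `⋂ Tᵏ K = 0`, then the spaces `Tᵏ (T K)ᗮ` span a dense subspace of `K`. -/
theorem range_linearIsometry_wanderingEmb (T : K →ₗᵢ[ℂ] K)
    (hT : ∀ x, (∀ k : ℕ, ∃ y, x = T^[k] y) → x = 0) (x : K) :
    ∃ a, (orthogonalFamily_wanderingEmb T).linearIsometry a = x := by
  suffices h : (⨆ k, LinearMap.range (wanderingEmb T k).toLinearMap).topologicalClosure = ⊤ by
    have hx : x ∈ LinearMap.range (orthogonalFamily_wanderingEmb T).linearIsometry.toLinearMap := by
      rw [OrthogonalFamily.range_linearIsometry, h]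
      trivial
    exact hx
  rw [Submodule.topologicalClosure_eq_top_iff, Submodule.eq_bot_iff]
  intro x hx
  have hx' : ∀ k (w : wandering T), inner ℂ (wanderingEmb T k w) x = 0 := fun k w =>
    (Submodule.mem_orthogonal _ _).1 hx _ (Submodule.mem_iSup_of_mem k ⟨w, rfl⟩)
  refine hT x fun k => ?_
  induction k with
  | zero => exact ⟨x, rfl⟩
  | succ k ih =>
    obtain ⟨y, hy⟩ := ih
    have hT' : ∀ (k : ℕ) (w : wandering T), wanderingEmb T k w = T^[k] w := by
      intro k w
      induction k with
      | zero => rfl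
      | succ k ih => rw [wanderingEmb_succ, ih, Function.iterate_succ_apply']
    have hi : ∀ (k : ℕ) (u v : K), inner ℂ (T^[k] u) (T^[k] v) = inner ℂ u v := by
      intro k u v
      induction k with
      | zero => rfl
      | succ k ih =>
        rw [Function.iterate_succ_apply', Function.iterate_succ_apply', T.inner_map_map, ih]
    obtain ⟨w, y', rfl⟩ := exists_eq_wandering_add T y
    have hw : (w : K) = 0 := by
      have h0 := hx' k w
      have h1 : inner ℂ (w : K) (T y') = 0 := inner_eq_zero_symm.1 (mem_wandering_iff.1 w.2 y')
      rw [hy, hT', hi, inner_add_right, h1, add_zero, inner_self_eq_zero] at h0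
      exact h0
    exact ⟨y', by rw [hy, hw, zero_add, Function.iterate_succ_apply]⟩

end Wold

/-! ### Factorizations of an isometry and operators on its wandering subspace -/

section Factorization

open ContinuousLinearMap

variable {K : Type*} [NormedAddCommGroup K] [InnerProductSpace ℂ K] [CompleteSpace K]

/-- The compression `x ↦ P X x` of an operator to the wandering subspace of `T`. -/
noncomputable def compress (T : K →ₗᵢ[ℂ] K) (X : K →L[ℂ] K) : wandering T →L[ℂ] wandering T :=
  adjoint (wandering T).subtypeL ∘L X ∘L (wandering T).subtypeL

theorem inner_compress (T : K →ₗᵢ[ℂ] K) (X : K →L[ℂ] K) (v w : wandering T) :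
    inner ℂ v (compress T X w) = inner ℂ (v : K) (X w) :=
  adjoint_inner_right (wandering T).subtypeL v (X w)

theorem star_compress (T : K →ₗᵢ[ℂ] K) (X : K →L[ℂ] K) :
    star (compress T X) = compress T (star X) := by
  simp only [star_eq_adjoint]
  refine ((eq_adjoint_iff _ _).2 fun v w => ?_).symm
  rw [inner_compress, ← inner_conj_symm, inner_compress, inner_conj_symm, adjoint_inner_left]

theorem coe_compress_of_mem {T : K →ₗᵢ[ℂ] K} {X : K →L[ℂ] K} {w : wandering T}
    (h : X w ∈ wandering T) : (compress T X w : K) = X w := by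
  suffices compress T X w = ⟨X w, h⟩ from congrArg Subtype.val this
  exact ext_inner_left ℂ fun v => inner_compress T X v w

variable {T : K →ₗᵢ[ℂ] K} {X Y : K →L[ℂ] K}

/-- If `T = Y X`, then `Y*` leaves the wandering subspace of `T` invariant. -/
theorem coe_compress_star (hYX : ∀ x, Y (X x) = T x) (hXY : ∀ x, X (Y x) = T x)
    (w : wandering T) : (compress T (star Y) w : K) = star Y w := by
  refine coe_compress_of_mem (mem_wandering_iff.2 fun y => ?_)
  have : Y (T y) = T (Y y) := by rw [← hYX (Y y), hXY]
  rw [star_eq_adjoint, adjoint_inner_right, this]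
  exact mem_wandering_iff.1 w.2 _

/-- If `T = X Y = Y X`, then on the wandering subspace `X` acts as `A + T B`, where `A` and `B` are
the compressions of `X` and `Y*`. -/
theorem apply_eq_compress_add (hX : star X * X = 1) (hYX : ∀ x, Y (X x) = T x)
    (hXY : ∀ x, X (Y x) = T x) (w : wandering T) :
    X w = compress T X w + T (compress T (star Y) w) := by
  have hXi : ∀ x y, inner ℂ (X x) (X y) = inner ℂ x y := fun x y => by
    rw [← adjoint_inner_right, ← star_eq_adjoint, ← mul_apply_eq_comp, hX, one_apply_eq_self]
  have hmem : X w - T (compress T (star Y) w) ∈ wandering T := by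
    refine mem_wandering_iff.2 fun y => ?_
    rw [inner_sub_right, T.inner_map_map, coe_compress_star hYX hXY, star_eq_adjoint,
      adjoint_inner_right, ← hXY, hXi, sub_self]
  have h : compress T X w = ⟨_, hmem⟩ := by
    refine ext_inner_left ℂ fun v => ?_
    rw [inner_compress, Submodule.coe_inner, inner_sub_right,
      inner_eq_zero_symm.1 (mem_wandering_iff.1 v.2 _), sub_zero]
  rw [h, sub_add_cancel]

/-- The operators `A` and `B` form a column isometry with orthogonal ranges. Apply `X* X = 1` to
`apply_eq_compress_add` and compare the components in the wandering subspace and in `T K`. -/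
theorem compress_relations (hX : star X * X = 1) (hY : star Y * Y = 1)
    (hYX : ∀ x, Y (X x) = T x) (hXY : ∀ x, X (Y x) = T x) :
    star (compress T X) * compress T X + star (compress T (star Y)) * compress T (star Y) = 1 ∧
      star (compress T X) * compress T (star Y) = 0 := by
  -- In this identity the first summand and the right-hand side lie in the wandering subspace, the
  -- second summand is orthogonal to it.
  have key : ∀ w : wandering T,
      ((star (compress T X) (compress T X w) +
        star (compress T (star Y)) (compress T (star Y) w) : wandering T) : K) +
        T (star (compress T X) (compress T (star Y) w)) = w := fun w => by
    set b := compress T (star Y) w with hb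
    have hXX : ∀ x, star X (X x) = x := fun x => by
      rw [← mul_apply_eq_comp, hX, one_apply_eq_self]
    have h1 : (star (compress T X) (compress T X w) : K) = w - Y b := by
      rw [star_compress, coe_compress_star hXY hYX,
        eq_sub_of_add_eq (apply_eq_compress_add hX hYX hXY w).symm, map_sub, hXX, ← hXY, hXX]
    have h2 := apply_eq_compress_add hY hXY hYX b
    rw [star_compress T (star Y), star_star, Submodule.coe_add, h1, star_compress T X]
    nth_rewrite 1 [h2]
    abel
  have hzero : ∀ w : wandering T, star (compress T X) (compress T (star Y) w) = 0 := fun w => by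
    refine Subtype.ext (eq_zero_of_mem_wandering (T := T) ?_)
    rw [eq_sub_of_add_eq' (key w)]
    exact Submodule.sub_mem _ w.2 (Subtype.mem _)
  refine ⟨ContinuousLinearMap.ext fun w => Subtype.ext ?_, ContinuousLinearMap.ext hzero⟩
  have h := key w
  rw [hzero, Submodule.coe_zero, map_zero, add_zero] at h
  exact h

/-- Exchanging `X` and `Y` in `compress_relations` replaces `A` by `B*` and `B` by `A*`. -/
theorem compress_relations_swap (hX : star X * X = 1) (hY : star Y * Y = 1)
    (hYX : ∀ x, Y (X x) = T x) (hXY : ∀ x, X (Y x) = T x) :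
    compress T X * star (compress T X) + compress T (star Y) * star (compress T (star Y)) = 1 ∧
      compress T (star Y) * star (compress T X) = 0 := by
  obtain ⟨h1, h2⟩ := compress_relations hY hX hXY hYX
  have hX' : star (compress T (star X)) = compress T X := by rw [star_compress, star_star]
  have hY' : star (compress T (star Y)) = compress T Y := by rw [star_compress, star_star]
  rw [hX', star_compress T Y, add_comm] at h1
  rw [star_compress T Y] at h2
  rw [hY', star_compress T X]
  exact ⟨h1, h2⟩

/-- If `Z Y = T R`, then the compressions of `Y*` and `Z*` have product zero. -/
theorem compress_star_mul_compress_star {Z X' R : K →L[ℂ] K}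
    (hYX : ∀ x, Y (X x) = T x) (hXY : ∀ x, X (Y x) = T x)
    (hZX : ∀ x, Z (X' x) = T x) (hXZ : ∀ x, X' (Z x) = T x) (hR : ∀ x, Z (Y x) = T (R x)) :
    compress T (star Y) * compress T (star Z) = 0 := by
  refine ContinuousLinearMap.ext fun w => Subtype.ext ?_
  rw [mul_apply_eq_comp, coe_compress_star hYX hXY, coe_compress_star hZX hXZ]
  refine ext_inner_left ℂ fun v => ?_
  rw [star_eq_adjoint, star_eq_adjoint, adjoint_inner_right, adjoint_inner_right, hR,
    mem_wandering_iff.1 w.2]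
  simp

end Factorization

/-! ### Ordered products and orthogonal projections -/

section Products

open ContinuousLinearMap

variable {E : Type*} [NormedAddCommGroup E] [InnerProductSpace ℂ E] {n : ℕ}

@[simp]
theorem descProd_zero (U : Fin n → E →L[ℂ] E) : descProd U 0 = 1 := by
  simp [descProd]

theorem descProd_succ (U : Fin n → E →L[ℂ] E) {k : ℕ} (hk : k < n) :
    descProd U (k + 1) = U ⟨k, hk⟩ * descProd U k := by
  rw [descProd, List.take_succ_eq_append_getElem (by simpa using hk), List.reverse_append]
  simp [descProd]

/-- The product of a commuting tuple does not depend on the order of the factors. -/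
theorem list_prod_eq_descProd {U : Fin n → E →L[ℂ] E} (h : ∀ i j, U i * U j = U j * U i) :
    (List.ofFn U).prod = descProd U n := by
  rw [descProd, List.take_of_length_le (by simp)]
  refine List.Perm.prod_eq' (List.reverse_perm _).symm ?_
  rw [List.pairwise_ofFn]
  exact fun i j _ => h i j

/-- Any two distinct factors of a commuting product can be split off. -/
theorem exists_mul_mul_eq_descProd {U : Fin n → E →L[ℂ] E} (h : ∀ i j, U i * U j = U j * U i)
    {i j : Fin n} (hij : i ≠ j) :
    ∃ R, (∀ k, U k * R = R * U k) ∧ U i * (U j * R) = descProd U n := by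
  have hp : List.Perm (List.finRange n) (i :: j :: ((List.finRange n).erase i).erase j) := by
    refine (List.perm_cons_erase (List.mem_finRange i)).trans (List.Perm.cons i ?_)
    exact List.perm_cons_erase ((List.mem_erase_of_ne hij.symm).2 (List.mem_finRange j))
  refine ⟨((((List.finRange n).erase i).erase j).map U).prod, fun k => ?_, ?_⟩
  · refine Commute.list_prod_right _ _ fun x hx => ?_
    obtain ⟨l, -, rfl⟩ := List.mem_map.1 hx
    exact h k l
  · rw [← list_prod_eq_descProd h, List.ofFn_eq_map]
    have := List.Perm.prod_eq' (hp.map U)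
      (List.pairwise_map.2 (List.pairwise_of_forall fun a b => h a b))
    rw [this]
    simp

/-- Any factor of a commuting product can be split off. -/
theorem exists_mul_eq_descProd {U : Fin n → E →L[ℂ] E} (h : ∀ i j, U i * U j = U j * U i)
    (i : Fin n) : ∃ R, (∀ k, U k * R = R * U k) ∧ U i * R = descProd U n := by
  have hp := List.perm_cons_erase (List.mem_finRange i)
  refine ⟨(((List.finRange n).erase i).map U).prod, fun k => ?_, ?_⟩
  · refine Commute.list_prod_right _ _ fun x hx => ?_
    obtain ⟨l, -, rfl⟩ := List.mem_map.1 hx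
    exact h k l
  · rw [← list_prod_eq_descProd h, List.ofFn_eq_map]
    have := List.Perm.prod_eq' (hp.map U)
      (List.pairwise_map.2 (List.pairwise_of_forall fun a b => h a b))
    rw [this]
    simp

variable [CompleteSpace E]

theorem descProd_mem_unitary {U : Fin n → E →L[ℂ] E} (hU : ∀ i, U i ∈ unitary (E →L[ℂ] E))
    (k : ℕ) : descProd U k ∈ unitary (E →L[ℂ] E) := by
  refine Submonoid.list_prod_mem _ fun x hx => ?_
  obtain ⟨i, rfl⟩ := List.mem_ofFn.1 (List.mem_of_mem_take (List.mem_reverse.1 hx))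
  exact hU i

theorem isStarProjection_conj {U P : E →L[ℂ] E} (hU : U ∈ unitary (E →L[ℂ] E))
    (hP : IsStarProjection P) : IsStarProjection (star U * P * U) where
  isIdempotentElem := by
    have h1 : U * star U = 1 := Unitary.mul_star_self_of_mem hU
    change star U * P * U * (star U * P * U) = star U * P * U
    calc star U * P * U * (star U * P * U) = star U * P * (U * star U) * (P * U) := by
          simp only [mul_assoc]
      _ = star U * (P * P) * U := by rw [h1]; simp only [mul_assoc, mul_one]
      _ = star U * P * U := by rw [hP.isIdempotentElem.eq]
  isSelfAdjoint := hP.isSelfAdjoint.conjugate' U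

/-- Projections whose sum is at most `1` are orthogonal. -/
theorem mul_eq_zero_of_add_le_one {P Q : E →L[ℂ] E} (hP : IsStarProjection P)
    (hQ : IsStarProjection Q) (h : P + Q ≤ 1) : Q * P = 0 := by
  have h1 : P ≤ 1 - Q := le_sub_iff_add_le.2 h
  have h2 := (hP.le_iff_mul_eq_right hQ.one_sub).1 h1
  rw [sub_mul, one_mul] at h2
  exact sub_eq_self.1 h2

/-- The sum of two orthogonal projections is a projection, hence at most `1`. -/
theorem add_le_one_of_mul_eq_zero {P Q : E →L[ℂ] E} (hP : IsStarProjection P)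
    (hQ : IsStarProjection Q) (h : Q * P = 0) : P + Q ≤ 1 := by
  have h' : P * Q = 0 := by
    have h3 := congrArg star h
    rwa [star_mul, hP.isSelfAdjoint.star_eq, hQ.isSelfAdjoint.star_eq, star_zero] at h3
  refine IsStarProjection.le_one ⟨?_, hP.isSelfAdjoint.add hQ.isSelfAdjoint⟩
  change (P + Q) * (P + Q) = P + Q
  rw [mul_add, add_mul, add_mul, h, h', hP.isIdempotentElem.eq, hQ.isIdempotentElem.eq, add_zero,
    zero_add]

/-- Projections that add up to the identity are mutually orthogonal. -/
theorem mul_eq_zero_of_sum_eq_one {R : Fin n → E →L[ℂ] E} (hR : ∀ i, IsStarProjection (R i))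
    (h : ∑ i, R i = 1) {i j : Fin n} (hij : i ≠ j) : R j * R i = 0 := by
  refine mul_eq_zero_of_add_le_one (hR i) (hR j) ?_
  rw [← h, ← Finset.add_sum_erase _ _ (Finset.mem_univ i)]
  refine add_le_add_right ?_ _
  exact Finset.single_le_sum (fun k _ => (hR k).nonneg)
    (Finset.mem_erase.2 ⟨hij.symm, Finset.mem_univ j⟩)

end Products

/-! ### Symbols of model tuples -/

section Symbols

variable {E : Type*} [NormedAddCommGroup E] [InnerProductSpace ℂ E] {n : ℕ}

/-- The operator pencil `z ↦ U (P^⊥ + z P)`. -/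
def pencil (U P : E →L[ℂ] E) (z : ℂ) : E →L[ℂ] E := U * ((1 - P) + z • P)

theorem pencil_eq (U P : E →L[ℂ] E) (z : ℂ) : pencil U P z = U * (1 + (z - 1) • P) := by
  rw [pencil, sub_smul, one_smul]
  congr 1
  abel

variable [CompleteSpace E]

/-- Moving a pencil past a unitary operator. -/
theorem pencil_mul_of_mem_unitary {U P D : E →L[ℂ] E} (hD : D ∈ unitary (E →L[ℂ] E)) (z : ℂ) :
    pencil U P z * D = U * D * (1 + (z - 1) • (star D * P * D)) := by
  have h1 : D * star D = 1 := Unitary.mul_star_self_of_mem hD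
  have h2 : D * (star D * P * D) = P * D := by
    rw [← mul_assoc, ← mul_assoc, h1, one_mul]
  rw [pencil_eq, mul_assoc, mul_assoc, mul_add, mul_smul_comm, h2, add_mul, smul_mul_assoc, mul_one,
    one_mul]

theorem pencil_mul_pencil {U P V Q : E →L[ℂ] E} (hV : V ∈ unitary (E →L[ℂ] E)) (z : ℂ) :
    pencil U P z * pencil V Q z = U * V * (1 + (z - 1) • (Q + star V * P * V) +
      (z - 1) ^ 2 • (star V * P * V * Q)) := by
  rw [pencil_eq V, ← mul_assoc, pencil_mul_of_mem_unitary hV, mul_assoc (U * V)]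
  congr 1
  simp only [mul_add, add_mul, one_mul, mul_one, smul_mul_assoc, mul_smul_comm, smul_add]
  rw [smul_smul, ← sq]
  abel

/-- Two pencils commute if their unitary parts do and the sums of their projections, the second one
conjugated by the unitary part of the first, agree and are at most `1`. -/
theorem pencil_commute {U P V Q : E →L[ℂ] E} (hU : U ∈ unitary (E →L[ℂ] E))
    (hV : V ∈ unitary (E →L[ℂ] E)) (hP : IsStarProjection P) (hQ : IsStarProjection Q)
    (hUV : U * V = V * U) (h : P + star U * Q * U = Q + star V * P * V)
    (hle : P + star U * Q * U ≤ 1) (z : ℂ) :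
    pencil U P z * pencil V Q z = pencil V Q z * pencil U P z := by
  rw [pencil_mul_pencil hV, pencil_mul_pencil hU,
    mul_eq_zero_of_add_le_one hP (isStarProjection_conj hU hQ) hle,
    mul_eq_zero_of_add_le_one hQ (isStarProjection_conj hV hP) (h ▸ hle), hUV, h]

/-- The sum of the first `k` conjugated projections in the definition of a model tuple. -/
noncomputable def partialSum (U P : Fin n → E →L[ℂ] E) (k : ℕ) : E →L[ℂ] E :=
  ∑ j ∈ Finset.univ.filter (fun j : Fin n => (j : ℕ) < k), star (descProd U j) * P j * descProd U j

theorem partialSum_zero (U P : Fin n → E →L[ℂ] E) : partialSum U P 0 = 0 := by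
  simp [partialSum]

theorem partialSum_self (U P : Fin n → E →L[ℂ] E) :
    partialSum U P n = ∑ j : Fin n, star (descProd U j) * P j * descProd U j := by
  simp [partialSum]

theorem partialSum_succ (U P : Fin n → E →L[ℂ] E) {k : ℕ} (hk : k < n) :
    partialSum U P (k + 1) =
      star (descProd U k) * P ⟨k, hk⟩ * descProd U k + partialSum U P k := by
  have h : Finset.univ.filter (fun j : Fin n => (j : ℕ) < k + 1) =
      insert ⟨k, hk⟩ (Finset.univ.filter (fun j : Fin n => (j : ℕ) < k)) := by
    ext j
    simp only [Finset.mem_filter, Finset.mem_univ, true_and, Finset.mem_insert, Fin.ext_iff]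
    omega
  rw [partialSum, h, Finset.sum_insert (by simp)]
  rfl

/-- After moving the unitary parts to the left, an ordered product of pencils has factors
`1 + (z - 1) R` with mutually orthogonal projections `R`, so only the terms linear in `z - 1`
survive. -/
theorem descProd_pencil {U P : Fin n → E →L[ℂ] E} (hU : ∀ i, U i ∈ unitary (E →L[ℂ] E))
    (hP : ∀ i, IsStarProjection (P i))
    (hd : ∑ j : Fin n, star (descProd U j) * P j * descProd U j = 1) (z : ℂ) {k : ℕ} (hk : k ≤ n) :
    descProd (fun i => pencil (U i) (P i) z) k =
      descProd U k * (1 + (z - 1) • partialSum U P k) := by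
  induction k with
  | zero => simp [partialSum_zero]
  | succ k ih =>
    have hk' : k < n := hk
    have h0 : star (descProd U k) * P ⟨k, hk'⟩ * descProd U k * partialSum U P k = 0 := by
      rw [partialSum, Finset.mul_sum]
      refine Finset.sum_eq_zero fun j hj => ?_
      refine mul_eq_zero_of_sum_eq_one (i := j) (j := ⟨k, hk'⟩)
        (R := fun j : Fin n => star (descProd U j) * P j * descProd U j)
        (fun i => isStarProjection_conj (descProd_mem_unitary hU _) (hP i)) hd ?_
      rintro rfl
      simp at hj
    rw [descProd_succ _ hk', ih hk'.le, ← mul_assoc,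
      pencil_mul_of_mem_unitary (descProd_mem_unitary hU k), ← descProd_succ, mul_assoc,
      partialSum_succ U P hk']
    congr 1
    rw [add_mul, one_mul, smul_mul_assoc, mul_add, mul_one, mul_smul_comm, h0, smul_zero, add_zero,
      smul_add]
    abel

/-- The derivative at `1` of the ordered product of pencils recovers the sum of the conjugated
projections; no orthogonality of these is needed. -/
theorem hasDerivAt_descProd_pencil {U P : Fin n → E →L[ℂ] E}
    (hU : ∀ i, U i ∈ unitary (E →L[ℂ] E)) {k : ℕ} (hk : k ≤ n) :
    HasDerivAt (fun z => descProd (fun i => pencil (U i) (P i) z) k)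
      (descProd U k * partialSum U P k) 1 := by
  have h1 : (fun i => pencil (U i) (P i) 1) = U := by
    funext i
    simp [pencil_eq]
  induction k with
  | zero => simpa [partialSum_zero] using hasDerivAt_const (1 : ℂ) (1 : E →L[ℂ] E)
  | succ k ih =>
    have hk' : k < n := hk
    have hp : HasDerivAt (fun z => pencil (U ⟨k, hk'⟩) (P ⟨k, hk'⟩) z)
        (U ⟨k, hk'⟩ * P ⟨k, hk'⟩) 1 := by
      simp only [pencil_eq]
      have h := (((hasDerivAt_id (1 : ℂ)).sub_const 1).smul_const (P ⟨k, hk'⟩)).const_add 1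
      simpa using h.const_mul (U ⟨k, hk'⟩)
    have h := hp.mul (ih hk'.le)
    have hD : descProd U k * star (descProd U k) = 1 :=
      Unitary.mul_star_self_of_mem (descProd_mem_unitary hU k)
    have he : descProd U (k + 1) * partialSum U P (k + 1) =
        U ⟨k, hk'⟩ * P ⟨k, hk'⟩ * descProd (fun i => pencil (U i) (P i) 1) k +
          pencil (U ⟨k, hk'⟩) (P ⟨k, hk'⟩) 1 * (descProd U k * partialSum U P k) := by
      rw [h1, congrFun h1 ⟨k, hk'⟩, partialSum_succ U P hk', descProd_succ U hk', mul_add]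
      congr 1
      calc U ⟨k, hk'⟩ * descProd U k * (star (descProd U k) * P ⟨k, hk'⟩ * descProd U k)
          = U ⟨k, hk'⟩ * (descProd U k * star (descProd U k)) * P ⟨k, hk'⟩ * descProd U k := by
            simp only [mul_assoc]
        _ = _ := by rw [hD, mul_one]
    rw [he]
    refine h.congr_of_eventuallyEq (Filter.Eventually.of_forall fun z => ?_)
    exact descProd_succ _ hk'

theorem differentiable_pencil (U P : E →L[ℂ] E) : Differentiable ℂ (pencil U P) := by
  unfold pencil
  fun_prop

theorem differentiable_descProd_pencil (U P : Fin n → E →L[ℂ] E) {k : ℕ} (hk : k ≤ n) :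
    Differentiable ℂ (fun z => descProd (fun i => pencil (U i) (P i) z) k) := by
  induction k with
  | zero => simp
  | succ k ih =>
    have h := (differentiable_pencil (U ⟨k, hk⟩) (P ⟨k, hk⟩)).mul (ih (Nat.le_of_succ_le hk))
    have he : (fun z => descProd (fun i => pencil (U i) (P i) z) (k + 1)) =
        pencil (U ⟨k, hk⟩) (P ⟨k, hk⟩) * fun z => descProd (fun i => pencil (U i) (P i) z) k := by
      funext z
      exact descProd_succ _ hk
    rw [he]
    exact h

/-- Entire functions that agree on the disc agree everywhere. -/
theorem eq_of_eq_on_disc {X : Type*} [NormedAddCommGroup X] [NormedSpace ℂ X] [CompleteSpace X]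
    {f g : ℂ → X} (hf : Differentiable ℂ f) (hg : Differentiable ℂ g)
    (h : ∀ z : 𝔻, f z = g z) : f = g := by
  refine AnalyticOnNhd.eq_of_eventuallyEq (𝕜 := ℂ) (z₀ := 0) (fun z _ => hf.analyticAt z)
    (fun z _ => hg.analyticAt z) ?_
  filter_upwards [Metric.ball_mem_nhds (0 : ℂ) one_pos] with z hz
  exact h (Complex.UnitDisc.mk z (mem_ball_zero_iff.1 hz))

/-- Commuting pencils whose product is the coordinate function form a model tuple, provided that
their leading coefficients have pairwise zero products. -/
theorem isModelNIsometry_pencil {U P : Fin n → E →L[ℂ] E}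
    (hU : ∀ i, U i ∈ unitary (E →L[ℂ] E)) (hP : ∀ i, IsStarProjection (P i))
    (hcomm : ∀ i j, ∀ z : 𝔻, pencil (U i) (P i) z * pencil (U j) (P j) z =
      pencil (U j) (P j) z * pencil (U i) (P i) z)
    (hprod : ∀ z : 𝔻, descProd (fun i => pencil (U i) (P i) z) n = (z : ℂ) • 1)
    (hlead : ∀ i j, i ≠ j → U i * P i * (U j * P j) = 0) :
    IsModelNIsometry fun i => pencil (U i) (P i) := by
  have h1 : ∀ i, pencil (U i) (P i) 1 = U i := fun i => by simp [pencil_eq]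
  have hcomm' : ∀ i j, ∀ z : ℂ, pencil (U i) (P i) z * pencil (U j) (P j) z =
      pencil (U j) (P j) z * pencil (U i) (P i) z := fun i j => congrFun
    (eq_of_eq_on_disc ((differentiable_pencil _ _).mul (differentiable_pencil _ _))
      ((differentiable_pencil _ _).mul (differentiable_pencil _ _)) (hcomm i j))
  have hprod' := eq_of_eq_on_disc (differentiable_descProd_pencil U P le_rfl)
    (differentiable_id.smul_const (1 : E →L[ℂ] E)) hprod
  have ha : ∀ i j, U i * U j = U j * U i := fun i j => by
    have h := hcomm' i j 1
    rwa [h1, h1] at h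
  have hb : descProd U n = 1 := by
    have h := congrFun hprod' 1
    simpa [h1] using h
  -- The products of the leading coefficients are the coefficients of `z²` in the products of
  -- pencils.
  have hzero : ∀ i j, i ≠ j → star (U i) * P j * U i * P i = 0 := fun i j hij => by
    have hu : star (U j) * U j = 1 := Unitary.star_mul_self_of_mem (hU j)
    calc star (U i) * P j * U i * P i
        = star (U i) * (star (U j) * U j) * P j * U i * P i := by rw [hu, mul_one]
      _ = star (U i) * star (U j) * (U j * P j * (U i * P i)) := by simp only [mul_assoc]
      _ = 0 := by rw [hlead j i hij.symm, mul_zero]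
  refine ⟨U, P, hU, hP, fun _ _ => rfl, ha, ?_, fun i j hij => ⟨?_, ?_⟩, ?_⟩
  · rw [list_prod_eq_descProd ha, hb]
  · -- At `z = 2` the factors `z - 1` in the products of pencils are `1`.
    have h := hcomm' j i 2
    rw [pencil_mul_pencil (hU i), pencil_mul_pencil (hU j), hzero i j hij, hzero j i hij.symm,
      ha j i] at h
    have hu : star (U i * U j) * (U i * U j) = 1 :=
      Unitary.star_mul_self_of_mem (mul_mem (hU i) (hU j))
    have h' := isLeftRegular_of_mul_eq_one hu h
    norm_num at h'
    exact h'
  · exact add_le_one_of_mul_eq_zero (hP i) (isStarProjection_conj (hU i) (hP j)) (hzero i j hij)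
  · -- Compare the derivatives at `1` of the two sides of `hprod'`.
    have h := hasDerivAt_descProd_pencil (P := P) hU le_rfl
    rw [hprod', hb, one_mul, partialSum_self] at h
    simpa using h.unique ((hasDerivAt_id (1 : ℂ)).smul_const (1 : E →L[ℂ] E))

end Symbols

open HardySpace

/-! ### Multiplication by pencils and by inner functions -/

section Multiplication

variable {E F : Type*} [NormedAddCommGroup E] [InnerProductSpace ℂ E] [CompleteSpace E]
  [NormedAddCommGroup F] [InnerProductSpace ℂ F] [CompleteSpace F] {n : ℕ}

/-- Multiplication by the pencil `z ↦ U (P^⊥ + z P)` on the Hardy space. -/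
noncomputable def pencilMul (U P : E →L[ℂ] E) : HardySpace E →L[ℂ] HardySpace E :=
  diag U ∘L (diag (1 - P) + (shift E).toContinuousLinearMap ∘L diag P)

@[simp]
theorem pencilMul_apply (U P : E →L[ℂ] E) (f : HardySpace E) (z : 𝔻) :
    pencilMul U P f z = pencil U P z (f z) := by
  simp [pencilMul, pencil]

theorem norm_diag_of_norm_map {A : E →L[ℂ] F} (hA : ∀ x, ‖A x‖ = ‖x‖) (f : HardySpace E) :
    ‖diag A f‖ = ‖f‖ := by
  refine (sq_eq_sq₀ (norm_nonneg _) (norm_nonneg _)).1 ?_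
  refine (hasSum_norm_coeff_sq _).unique ?_
  simpa [hA] using hasSum_norm_coeff_sq f

/-- A projection and its complement have orthogonal ranges. -/
theorem inner_one_sub_apply {P : E →L[ℂ] E} (hP : IsStarProjection P) (x y : E) :
    inner ℂ ((1 - P) x) (P y) = 0 := by
  have h : star P * (1 - P) = 0 := by
    rw [hP.isSelfAdjoint.star_eq, mul_sub, mul_one, hP.isIdempotentElem.eq, sub_self]
  rw [← ContinuousLinearMap.adjoint_inner_left, ← ContinuousLinearMap.star_eq_adjoint,
    ← mul_apply_eq_comp, h]
  simp

/-- The terms `P^⊥ f` and `z P f` of a pencil multiple are orthogonal, so multiplication by a pencil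
is isometric. -/
theorem norm_pencilMul {U P : E →L[ℂ] E} (hU : U ∈ unitary (E →L[ℂ] E)) (hP : IsStarProjection P)
    (f : HardySpace E) : ‖pencilMul U P f‖ = ‖f‖ := by
  have hUn : ∀ x, ‖U x‖ = ‖x‖ := (ContinuousLinearMap.norm_map_iff_adjoint_comp_self U).2
    (Unitary.star_mul_self_of_mem hU)
  have h1 : inner ℂ (diag (1 - P) f) (shift E (diag P f)) = 0 := by
    refine (hasSum_inner_coeff _ _).unique ?_
    have : (fun k => inner ℂ (coeff E k (diag (1 - P) f)) (coeff E k (shift E (diag P f)))) =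
        fun _ => (0 : ℂ) := by
      funext k
      cases k with
      | zero => simp
      | succ k =>
        rw [coeff_diag, coeff_succ_shift, coeff_diag]
        exact inner_one_sub_apply hP _ _
    rw [this]
    exact hasSum_zero
  have h2 : inner ℂ (diag (1 - P) f) (diag P f) = 0 := by
    refine (hasSum_inner_coeff _ _).unique ?_
    simp only [coeff_diag, inner_one_sub_apply hP]
    exact hasSum_zero
  have h3 : diag (1 - P) f + diag P f = f := ext_coeff fun k => by simp
  have h4 : pencilMul U P f = diag U (diag (1 - P) f + shift E (diag P f)) := rfl
  rw [h4, norm_diag_of_norm_map hUn, ← mul_self_inj (norm_nonneg _) (norm_nonneg _),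
    norm_add_sq_eq_norm_sq_add_norm_sq_of_inner_eq_zero _ _ h1, LinearIsometry.norm_map,
    ← norm_add_sq_eq_norm_sq_add_norm_sq_of_inner_eq_zero _ _ h2, h3]

theorem descProd_apply {V : Fin n → HardySpace E →L[ℂ] HardySpace E} {Φ : Fin n → E →L[ℂ] E}
    {z : 𝔻} (h : ∀ j f, V j f z = Φ j (f z)) {k : ℕ} (hk : k ≤ n) (f : HardySpace E) :
    descProd V k f z = descProd Φ k (f z) := by
  induction k with
  | zero => simp
  | succ k ih =>
    rw [descProd_succ V hk, descProd_succ Φ hk, mul_apply_eq_comp,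
      mul_apply_eq_comp, h, ih (Nat.le_of_succ_le hk)]

/-- An operator that intertwines two tuples intertwines their partial products. -/
theorem descProd_intertwine {E F : Type*} [NormedAddCommGroup E] [InnerProductSpace ℂ E]
    [NormedAddCommGroup F] [InnerProductSpace ℂ F] {Φ : Fin n → F →L[ℂ] F}
    {Ψ : Fin n → E →L[ℂ] E} {A : E →L[ℂ] F} (h : ∀ j x, Φ j (A x) = A (Ψ j x)) {k : ℕ} (hk : k ≤ n)
    (x : E) : descProd Φ k (A x) = A (descProd Ψ k x) := by
  induction k with
  | zero => simp
  | succ k ih =>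
    rw [descProd_succ Φ hk, descProd_succ Ψ hk, mul_apply_eq_comp,
      mul_apply_eq_comp, ih (Nat.le_of_succ_le hk), h]

/-- The symbol of an isometric multiplication operator is contractive: test the operator on the
Szegő kernel at the given point. -/
theorem norm_symbol_le_one {Θ : ℂ → E →L[ℂ] F} {M : HardySpace E →ₗᵢ[ℂ] HardySpace F}
    (hM : ∀ f, IsMul Θ f (M f)) (z : 𝔻) : ‖Θ z‖ ≤ 1 := by
  refine ContinuousLinearMap.opNorm_le_bound _ zero_le_one fun x => ?_
  rw [one_mul]
  set c := kernelConst z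
  have hc : 0 < c := kernelConst_pos z
  set y := Θ z x with hy
  have h1 : inner ℂ (kernel z y) (M (kernel z x)) = ((c * ‖y‖ ^ 2 : ℝ) : ℂ) := by
    rw [inner_kernel, hM, kernel_apply_self, map_smul, inner_smul_right, ← hy,
      inner_self_eq_norm_sq_to_K]
    push_cast
    rfl
  have h2 := norm_inner_le_norm (𝕜 := ℂ) (kernel z y) (M (kernel z x))
  rw [h1, Complex.norm_real, Real.norm_of_nonneg (by positivity), M.norm_map] at h2
  have h3 : (c * ‖y‖ ^ 2) ^ 2 ≤ (c * ‖y‖ ^ 2) * (c * ‖x‖ ^ 2) := by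
    rw [← norm_kernel_sq, ← norm_kernel_sq, ← mul_pow]
    refine pow_le_pow_left₀ (by positivity) ?_ 2
    rw [norm_kernel_sq]
    exact h2
  by_contra! hlt
  have hy0 : 0 < ‖y‖ := (norm_nonneg x).trans_lt hlt
  rw [sq] at h3
  have h4 := le_of_mul_le_mul_left (le_of_mul_le_mul_left h3 (by positivity)) hc
  exact (pow_lt_pow_left₀ hlt (norm_nonneg x) two_ne_zero).not_ge h4

/-- An inner function can be cancelled from the left in products with Hardy space functions. -/
theorem IsInner.eq_of_mul_eq {Θ : ℂ → E →L[ℂ] F} (hΘ : IsInner Θ) {f g : HardySpace E}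
    (h : ∀ z : 𝔻, Θ z (f z) = Θ z (g z)) : f = g := by
  obtain ⟨-, M, hM⟩ := hΘ
  refine M.injective (DFunLike.ext _ _ fun z => ?_)
  rw [hM, hM, h]

theorem IsMul.unique {Θ : ℂ → E →L[ℂ] F} {f : HardySpace E} {g g' : HardySpace F}
    (h : IsMul Θ f g) (h' : IsMul Θ f g') : g = g' :=
  DFunLike.ext _ _ fun z => (h z).trans (h' z).symm

/-- A model tuple acts on the Hardy space by commuting isometries with product `M_z`. -/
theorem IsModelNIsometry.exists_operators {Φ : Fin n → ℂ → E →L[ℂ] E} (hΦ : IsModelNIsometry Φ) :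
    ∃ V : Fin n → HardySpace E →L[ℂ] HardySpace E,
      (∀ j f, IsMul (Φ j) f (V j f)) ∧ (∀ j f, ‖V j f‖ = ‖f‖) ∧
      (∀ i j, ∀ z : 𝔻, Φ i z * Φ j z = Φ j z * Φ i z) ∧
      ∀ z : 𝔻, descProd (fun j => Φ j z) n = (z : ℂ) • 1 := by
  obtain ⟨U, P, hU, hP, hUP, ha, hb, hc, hd⟩ := hΦ
  have hΦ' : ∀ j, ∀ z : 𝔻, Φ j z = pencil (U j) (P j) z := hUP
  refine ⟨fun j => pencilMul (U j) (P j), fun j f z => ?_, fun j => norm_pencilMul (hU j) (hP j),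
    fun i j z => ?_, fun z => ?_⟩
  · rw [hΦ', pencilMul_apply]
  · rcases eq_or_ne i j with rfl | hij
    · rfl
    · rw [hΦ', hΦ']
      exact pencil_commute (hU i) (hU j) (hP i) (hP j) (ha i j) (hc i j hij).1 (hc i j hij).2 z
  · simp only [hΦ']
    rw [descProd_pencil hU hP hd _ le_rfl, ← list_prod_eq_descProd ha, hb, partialSum_self, hd,
      one_mul, sub_smul, one_smul, add_sub_cancel]

end Multiplication

/-! ### Invariant subspaces have representations -/

section Existence

variable {W : Type*} [NormedAddCommGroup W] [InnerProductSpace ℂ W] [CompleteSpace W]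
  {K : Type*} [NormedAddCommGroup K] [InnerProductSpace ℂ K]

/-- The evaluation `w ↦ w(z)` of the functions in the wandering subspace of an isometry `T` of `K`,
where `K` is regarded as a space of functions by means of `J`. -/
noncomputable def wanderingSymbol (J : K →ₗᵢ[ℂ] HardySpace W) (T : K →ₗᵢ[ℂ] K) (z : ℂ) :
    wandering T →L[ℂ] W :=
  eval W z ∘L (J.comp (wandering T).subtypeₗᵢ).toContinuousLinearMap

theorem wanderingSymbol_apply (J : K →ₗᵢ[ℂ] HardySpace W) (T : K →ₗᵢ[ℂ] K) (z : 𝔻)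
    (w : wandering T) : wanderingSymbol J T z w = J w z :=
  eval_apply z _

variable [CompleteSpace K]

/-- If `J` intertwines `T` with `M_z`, then the Wold decomposition of `T` is multiplication by
`wanderingSymbol J T`. -/
theorem exists_isMul_wanderingSymbol {J : K →ₗᵢ[ℂ] HardySpace W} {T : K →ₗᵢ[ℂ] K}
    (hT : ∀ f, J (T f) = shift W (J f)) :
    ∃ M : HardySpace (wandering T) →ₗᵢ[ℂ] HardySpace W,
      (∀ f, IsMul (wanderingSymbol J T) f (M f)) ∧ Set.range M = Set.range J := by
  have hpure : ∀ x, (∀ k : ℕ, ∃ y, x = T^[k] y) → x = 0 := by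
    intro x hx
    refine J.injective (ext_coeff fun j => ?_)
    obtain ⟨y, rfl⟩ := hx (j + 1)
    have h : ∀ k : ℕ, J (T^[k] y) = (shift W)^[k] (J y) := by
      intro k
      induction k with
      | zero => rfl
      | succ k ih => rw [Function.iterate_succ_apply', Function.iterate_succ_apply', hT, ih]
    rw [h, coeff_iterate_shift_of_lt _ (Nat.lt_succ_self j), map_zero, map_zero]
  let M₀ := (orthogonalFamily_wanderingEmb T).linearIsometry
  refine ⟨J.comp (M₀.comp (coeffsIsometry (wandering T)).toLinearIsometry),
    fun f z => ?_, Set.Subset.antisymm ?_ ?_⟩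
  · have h1 := ((orthogonalFamily_wanderingEmb T).hasSum_linearIsometry
      (coeffsIsometry (wandering T) f)).mapL (eval W z ∘L J.toContinuousLinearMap)
    have h2 := (hasSum_apply f z).mapL (wanderingSymbol J T z)
    have h3 : ∀ (k : ℕ) (w : wandering T),
        (eval W z ∘L J.toContinuousLinearMap) (wanderingEmb T k w) =
          wanderingSymbol J T z ((z : ℂ) ^ k • w) := by
      intro k w
      induction k with
      | zero => rw [pow_zero, one_smul]; rfl
      | succ k ih =>
        have h4 : (eval W z ∘L J.toContinuousLinearMap) (wanderingEmb T (k + 1) w) =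
            (z : ℂ) • (eval W z ∘L J.toContinuousLinearMap) (wanderingEmb T k w) := by
          simp only [ContinuousLinearMap.comp_apply, LinearIsometry.coe_toContinuousLinearMap,
            eval_apply]
          rw [wanderingEmb_succ, hT, shift_apply]
        rw [h4, ih, ← map_smul, smul_smul, ← pow_succ']
    simp only [h3] at h1
    rw [← h1.unique h2]
    exact (eval_apply z _).symm
  · rintro _ ⟨f, rfl⟩
    exact ⟨_, rfl⟩
  · rintro _ ⟨x, rfl⟩
    obtain ⟨a, ha⟩ := range_linearIsometry_wanderingEmb T hpure x
    refine ⟨(coeffsIsometry (wandering T)).symm a, ?_⟩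
    have h6 : M₀ a = x := ha
    simp [h6]

theorem isInner_wanderingSymbol {J : K →ₗᵢ[ℂ] HardySpace W} {T : K →ₗᵢ[ℂ] K}
    {M : HardySpace (wandering T) →ₗᵢ[ℂ] HardySpace W}
    (hM : ∀ f, IsMul (wanderingSymbol J T) f (M f)) : IsInner (wanderingSymbol J T) :=
  ⟨⟨differentiableOn_eval.clm_comp (differentiableOn_const _), 1, norm_symbol_le_one hM⟩, M, hM⟩

end Existence

/-- The unitary and the projection of a pencil `A + z B` are recovered from the coefficients as
`A + B` and `B* B`. -/
theorem pencil_of_relations {E : Type*} [NormedAddCommGroup E] [InnerProductSpace ℂ E]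
    [CompleteSpace E] {A B : E →L[ℂ] E} (h1 : star A * A + star B * B = 1) (h2 : star A * B = 0)
    (h3 : A * star A + B * star B = 1) (h4 : B * star A = 0) :
    A + B ∈ unitary (E →L[ℂ] E) ∧ IsStarProjection (star B * B) ∧
      (A + B) * (star B * B) = B ∧ ∀ z, pencil (A + B) (star B * B) z = A + z • B := by
  have h2' : star B * A = 0 := by simpa using congrArg star h2
  have h4' : A * star B = 0 := by simpa using congrArg star h4
  have hB : B * (star B * B) = B := by
    rw [← mul_assoc, eq_sub_of_add_eq' h3, sub_mul, one_mul, mul_assoc, h2, mul_zero, sub_zero]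
  have hUP : (A + B) * (star B * B) = B := by
    rw [add_mul, ← mul_assoc, h4', zero_mul, zero_add, hB]
  refine ⟨Unitary.mem_iff.2 ⟨?_, ?_⟩, ⟨?_, IsSelfAdjoint.star_mul_self B⟩, hUP, fun z => ?_⟩
  · rw [star_add, add_mul, mul_add, mul_add, h2, h2', zero_add, add_zero, h1]
  · rw [star_add, add_mul, mul_add, mul_add, h4, h4', zero_add, add_zero, h3]
  · change star B * B * (star B * B) = star B * B
    rw [mul_assoc, hB]
  · rw [pencil, mul_add, mul_sub, mul_one, mul_smul_comm, hUP, add_sub_cancel_right]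

/-- Operators on a Hilbert space `K` that an isometric embedding `J` of `K` intertwines with a model
tuple give rise to a representation of the range of `J`. -/
theorem exists_isRepresentation_of_intertwine {W : Type*} [NormedAddCommGroup W]
    [InnerProductSpace ℂ W] [CompleteSpace W] {n : ℕ} {Φ : Fin n → ℂ → W →L[ℂ] W}
    (hΦ : IsModelNIsometry Φ) {S : Submodule ℂ (HardySpace W)}
    {K : Type u} [NormedAddCommGroup K] [InnerProductSpace ℂ K] [CompleteSpace K]
    {J : K →ₗᵢ[ℂ] HardySpace W} (hJ : Set.range J = S) {X : Fin n → K →L[ℂ] K}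
    (hJX : ∀ j f, IsMul (Φ j) (J f) (J (X j f))) :
    ∃ (W' : Type u) (_ : NormedAddCommGroup W') (_ : InnerProductSpace ℂ W')
      (_ : CompleteSpace W') (Θ : ℂ → W' →L[ℂ] W) (Ψ : Fin n → ℂ → W' →L[ℂ] W'),
      IsRepresentation Φ S Θ Ψ := by
  obtain ⟨V, hV, hVn, hcomm, hprod⟩ := hΦ.exists_operators
  have hXV : ∀ j f, J (X j f) = V j (J f) := fun j f => (hJX j f).unique (hV j _)
  have hXn : ∀ j f, ‖X j f‖ = ‖f‖ := fun j f => by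
    rw [← J.norm_map, hXV, hVn, J.norm_map]
  have hXc : ∀ i j, X i * X j = X j * X i := fun i j => by
    refine ContinuousLinearMap.ext fun f => J.injective (DFunLike.ext _ _ fun z => ?_)
    rw [mul_apply_eq_comp, mul_apply_eq_comp, hJX, hJX, hJX, hJX]
    exact DFunLike.congr_fun (hcomm i j z) _
  have hXT : ∀ f, J (descProd X n f) = shift W (J f) := fun f => by
    have h : descProd V n (J f) = J (descProd X n f) :=
      descProd_intertwine (A := J.toContinuousLinearMap) (fun j f => (hXV j f).symm) le_rfl f
    refine DFunLike.ext _ _ fun z => ?_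
    rw [← h, descProd_apply (fun j f => hV j f z) le_rfl, hprod, shift_apply]
    rfl
  let T : K →ₗᵢ[ℂ] K :=
    { toLinearMap := (descProd X n).toLinearMap
      norm_map' := fun f => by
        change ‖descProd X n f‖ = ‖f‖
        rw [← J.norm_map, hXT, (shift W).norm_map, J.norm_map] }
  have hT : ∀ f, J (T f) = shift W (J f) := hXT
  obtain ⟨M, hM, hMr⟩ := exists_isMul_wanderingSymbol hT
  have hΘ := isInner_wanderingSymbol hM
  -- `Y j` is the product of the `X i` with `i ≠ j`.
  choose Y hYc hXY using exists_mul_eq_descProd hXc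
  have hXY' : ∀ j f, X j (Y j f) = T f := fun j f => DFunLike.congr_fun (hXY j) f
  have hYX' : ∀ j f, Y j (X j f) = T f := fun j f => by
    rw [← hXY']
    exact (DFunLike.congr_fun (hYc j j) f).symm
  have hXs : ∀ j, star (X j) * X j = 1 := fun j =>
    (ContinuousLinearMap.norm_map_iff_adjoint_comp_self _).1 (hXn j)
  have hYs : ∀ j, star (Y j) * Y j = 1 := fun j =>
    (ContinuousLinearMap.norm_map_iff_adjoint_comp_self _).1 fun f => by
      rw [← hXn j, hXY', T.norm_map]
  let A : Fin n → wandering T →L[ℂ] wandering T := fun j => compress T (X j)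
  let B : Fin n → wandering T →L[ℂ] wandering T := fun j => compress T (star (Y j))
  have hrel : ∀ j, A j + B j ∈ unitary (wandering T →L[ℂ] wandering T) ∧
      IsStarProjection (star (B j) * B j) ∧ (A j + B j) * (star (B j) * B j) = B j ∧
      ∀ z, pencil (A j + B j) (star (B j) * B j) z = A j + z • B j := fun j => by
    obtain ⟨h1, h2⟩ := compress_relations (hXs j) (hYs j) (hYX' j) (hXY' j)
    obtain ⟨h3, h4⟩ := compress_relations_swap (hXs j) (hYs j) (hYX' j) (hXY' j)
    exact pencil_of_relations h1 h2 h3 h4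
  let U : Fin n → wandering T →L[ℂ] wandering T := fun j => A j + B j
  let P : Fin n → wandering T →L[ℂ] wandering T := fun j => star (B j) * B j
  have hpen : ∀ j z, pencil (U j) (P j) z = A j + z • B j := fun j => (hrel j).2.2.2
  have hint : ∀ j, ∀ (z : 𝔻) (w : wandering T), Φ j z (wanderingSymbol J T z w) =
      wanderingSymbol J T z (pencil (U j) (P j) z w) := fun j z w => by
    have h := apply_eq_compress_add (hXs j) (hYX' j) (hXY' j) w
    rw [hpen, wanderingSymbol_apply, ← hV j, ← hXV, h, map_add J, hT, HardySpace.add_apply,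
      shift_apply, _root_.add_apply, map_add, _root_.smul_apply,
      map_smul, wanderingSymbol_apply, wanderingSymbol_apply]
  have hmodel : IsModelNIsometry fun j => pencil (U j) (P j) := by
    refine isModelNIsometry_pencil (fun j => (hrel j).1) (fun j => (hrel j).2.1) ?_ ?_ ?_
    · refine fun i j z => ContinuousLinearMap.ext fun w => ?_
      have h := hΘ.eq_of_mul_eq
        (f := pencilMul (U i) (P i) (pencilMul (U j) (P j) (const _ w)))
        (g := pencilMul (U j) (P j) (pencilMul (U i) (P i) (const _ w))) fun z => by
          simp only [pencilMul_apply, ← hint]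
          exact DFunLike.congr_fun (hcomm i j z) _
      simpa using DFunLike.congr_fun h z
    · refine fun z => ContinuousLinearMap.ext fun w => ?_
      have hd := fun z : 𝔻 => descProd_apply (V := fun j => pencilMul (U j) (P j))
        (Φ := fun j => pencil (U j) (P j) z) (z := z) (fun j f => pencilMul_apply _ _ f z)
        le_rfl (const _ w)
      have h := hΘ.eq_of_mul_eq
        (f := descProd (fun j => pencilMul (U j) (P j)) n (const _ w))
        (g := shift _ (const _ w)) fun z => by
          rw [hd, ← descProd_intertwine (fun j x => hint j z x) le_rfl, hprod, shift_apply,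
            map_smul]
          rfl
      have h' := DFunLike.congr_fun h z
      rw [hd, shift_apply, const_apply] at h'
      exact h'
    · -- The leading coefficients are `Y i*` and `Y j*`, and `Y j * Y i` is divisible by `T`.
      intro i j hij
      rw [(hrel i).2.2.1, (hrel j).2.2.1]
      obtain ⟨R, -, hR⟩ := exists_mul_mul_eq_descProd hXc hij
      have hXinj : Function.Injective (X i) :=
        (AddMonoidHomClass.isometry_of_norm (X i) (hXn i)).injective
      have hYR : ∀ f, Y i f = X j (R f) := fun f => hXinj ((hXY' i f).trans
        (DFunLike.congr_fun hR f).symm)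
      exact compress_star_mul_compress_star (hYX' i) (hXY' i) (hYX' j) (hXY' j) (R := R)
        fun f => by rw [hYR, hYX']
  refine ⟨wandering T, inferInstance, inferInstance, inferInstance, wanderingSymbol J T, _, hΘ,
    hmodel, ?_, fun j z => ContinuousLinearMap.ext fun w => hint j z w⟩
  rw [← hJ, ← hMr]
  refine Set.Subset.antisymm ?_ ?_
  · rintro _ ⟨f, rfl⟩
    exact ⟨f, hM f⟩
  · rintro g ⟨f, hf⟩
    exact ⟨f, (hM f).unique hf⟩

/-- A closed jointly invariant subspace has a representation. -/
theorem IsJointlyInvariant.exists_isRepresentation {W : Type u} [NormedAddCommGroup W]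
    [InnerProductSpace ℂ W] [CompleteSpace W] {n : ℕ} {Φ : Fin n → ℂ → W →L[ℂ] W}
    (hΦ : IsModelNIsometry Φ) {S : Submodule ℂ (HardySpace W)}
    (hS : IsClosed (S : Set (HardySpace W))) (hinv : IsJointlyInvariant Φ S) :
    ∃ (W' : Type u) (_ : NormedAddCommGroup W') (_ : InnerProductSpace ℂ W')
      (_ : CompleteSpace W') (Θ : ℂ → W' →L[ℂ] W) (Ψ : Fin n → ℂ → W' →L[ℂ] W'),
      IsRepresentation Φ S Θ Ψ := by
  obtain ⟨V, hV, -⟩ := hΦ.exists_operators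
  have : CompleteSpace S := hS.completeSpace_coe
  have hVS : ∀ j (f : S), V j f ∈ S := fun j f => by
    obtain ⟨g, hg, hfg⟩ := hinv j f f.2
    rwa [(hV j f).unique hfg]
  exact exists_isRepresentation_of_intertwine hΦ (J := S.subtypeₗᵢ) Subtype.range_coe
    (X := fun j => (V j ∘L S.subtypeL).codRestrict S (hVS j)) fun j f => hV j f

/-! ### Properties of representations -/

section Representation

variable {W : Type*} [NormedAddCommGroup W] [InnerProductSpace ℂ W] [CompleteSpace W]
  {E : Type*} [NormedAddCommGroup E] [InnerProductSpace ℂ E] [CompleteSpace E]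
  {F : Type*} [NormedAddCommGroup F] [InnerProductSpace ℂ F] [CompleteSpace F]
  {n : ℕ} {Φ : Fin n → ℂ → W →L[ℂ] W} {S : Submodule ℂ (HardySpace W)}

theorem IsRepresentation.isJointlyInvariant {Θ : ℂ → E →L[ℂ] W} {Ψ : Fin n → ℂ → E →L[ℂ] E}
    (h : IsRepresentation Φ S Θ Ψ) : IsJointlyInvariant Φ S := by
  obtain ⟨⟨-, M, hM⟩, hΨ, hS, hint⟩ := h
  obtain ⟨V, hV, -⟩ := hΨ.exists_operators
  intro j f hf
  obtain ⟨g, hg⟩ : f ∈ mulRange Θ := hS ▸ hf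
  refine ⟨M (V j g), ?_, fun z => ?_⟩
  · rw [← SetLike.mem_coe, hS]
    exact ⟨V j g, hM _⟩
  · rw [hM, hV, hg]
    exact (DFunLike.congr_fun (hint j z) (g z)).symm

/-- A unitary operator between Hardy spaces that commutes with the shifts maps constants to
constants. -/
theorem apply_const_of_commute_shift (Ξ : HardySpace E ≃ₗᵢ[ℂ] HardySpace F)
    (hΞ : ∀ f, Ξ (shift E f) = shift F (Ξ f)) (x : E) :
    Ξ (const E x) = const F (coeff F 0 (Ξ (const E x))) := by
  refine eq_const_of_forall_inner_shift_eq_zero fun g => ?_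
  obtain ⟨f, rfl⟩ := Ξ.surjective g
  rw [← hΞ, Ξ.inner_map_map, inner_const_shift]

/-- Two inner functions with the same range differ by a constant unitary on the right. -/
theorem exists_unitary_of_mulRange_eq {Θ₁ : ℂ → E →L[ℂ] W} {Θ₂ : ℂ → F →L[ℂ] W}
    (h₁ : IsInner Θ₁) (h₂ : IsInner Θ₂) (h : mulRange Θ₁ = mulRange Θ₂) :
    ∃ τ : E ≃ₗᵢ[ℂ] F, ∀ z : 𝔻, Θ₁ z = Θ₂ z ∘L (τ : E →L[ℂ] F) := by
  obtain ⟨-, M₁, hM₁⟩ := h₁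
  obtain ⟨-, M₂, hM₂⟩ := h₂
  have hr₁ : ∀ f, ∃ g, M₂ g = M₁ f := fun f => by
    obtain ⟨g, hg⟩ : M₁ f ∈ mulRange Θ₂ := h ▸ ⟨f, hM₁ f⟩
    exact ⟨g, (hM₂ g).unique hg⟩
  have hr₂ : ∀ g, ∃ f, M₁ f = M₂ g := fun g => by
    obtain ⟨f, hf⟩ : M₂ g ∈ mulRange Θ₁ := h ▸ ⟨g, hM₂ g⟩
    exact ⟨f, (hM₁ f).unique hf⟩
  choose φ hφ using hr₁
  choose ψ hψ using hr₂
  let Ξ : HardySpace E ≃ₗᵢ[ℂ] HardySpace F :=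
    { toFun := φ
      invFun := ψ
      map_add' := fun f g => M₂.injective (by simp [hφ])
      map_smul' := fun c f => M₂.injective (by simp [hφ])
      left_inv := fun f => M₁.injective (by rw [hψ, hφ])
      right_inv := fun g => M₂.injective (by rw [hφ, hψ])
      norm_map' := fun f => by
        change ‖φ f‖ = ‖f‖
        rw [← M₂.norm_map, hφ, M₁.norm_map] }
  have hMΞ : ∀ f, M₂ (Ξ f) = M₁ f := hφ
  have hshift : ∀ f, Ξ (shift E f) = shift F (Ξ f) := fun f => by
    refine M₂.injective (DFunLike.ext _ _ fun z => ?_)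
    rw [hMΞ, hM₁, hM₂, shift_apply, shift_apply, map_smul, map_smul, ← hM₁, ← hM₂, hMΞ]
  have hshift' : ∀ g, Ξ.symm (shift F g) = shift E (Ξ.symm g) := fun g => by
    rw [LinearIsometryEquiv.symm_apply_eq, hshift, LinearIsometryEquiv.apply_symm_apply]
  have hc := apply_const_of_commute_shift Ξ hshift
  have hc' := apply_const_of_commute_shift Ξ.symm hshift'
  let τ : E ≃ₗᵢ[ℂ] F :=
    { toFun := fun x => coeff F 0 (Ξ (const E x))
      invFun := fun y => coeff E 0 (Ξ.symm (const F y))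
      map_add' := fun x y => by simp
      map_smul' := fun c x => by simp
      left_inv := fun x => by
        change coeff E 0 (Ξ.symm (const F (coeff F 0 (Ξ (const E x))))) = x
        rw [← hc, LinearIsometryEquiv.symm_apply_apply, coeff_zero_const]
      right_inv := fun y => by
        change coeff F 0 (Ξ (const E (coeff E 0 (Ξ.symm (const F y))))) = y
        rw [← hc', LinearIsometryEquiv.apply_symm_apply, coeff_zero_const]
      norm_map' := fun x => by
        change ‖coeff F 0 (Ξ (const E x))‖ = ‖x‖
        rw [← (const F).norm_map, ← hc, Ξ.norm_map, (const E).norm_map] }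
  refine ⟨τ, fun z => ContinuousLinearMap.ext fun x => ?_⟩
  have hz : M₂ (Ξ (const E x)) z = M₁ (const E x) z := by rw [hMΞ]
  rw [hM₁, hc, hM₂, const_apply, const_apply] at hz
  exact hz.symm

/-- Representations of the same subspace are unitarily equivalent by a constant unitary. -/
theorem IsRepresentation.exists_unitary {Θ₁ : ℂ → E →L[ℂ] W} {Ψ₁ : Fin n → ℂ → E →L[ℂ] E}
    {Θ₂ : ℂ → F →L[ℂ] W} {Ψ₂ : Fin n → ℂ → F →L[ℂ] F}
    (h₁ : IsRepresentation Φ S Θ₁ Ψ₁) (h₂ : IsRepresentation Φ S Θ₂ Ψ₂) :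
    ∃ τ : E ≃ₗᵢ[ℂ] F, (∀ z : 𝔻, Θ₁ z = Θ₂ z ∘L (τ : E →L[ℂ] F)) ∧
      ∀ j, ∀ z : 𝔻, Ψ₂ j z ∘L (τ : E →L[ℂ] F) = (τ : E →L[ℂ] F) ∘L Ψ₁ j z := by
  obtain ⟨hΘ₁, hΨ₁, hS₁, hint₁⟩ := h₁
  obtain ⟨hΘ₂, hΨ₂, hS₂, hint₂⟩ := h₂
  obtain ⟨τ, hτ⟩ := exists_unitary_of_mulRange_eq hΘ₁ hΘ₂ (hS₁.symm.trans hS₂)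
  obtain ⟨V₁, hV₁, -⟩ := hΨ₁.exists_operators
  obtain ⟨V₂, hV₂, -⟩ := hΨ₂.exists_operators
  refine ⟨τ, hτ, fun j z => ContinuousLinearMap.ext fun x => ?_⟩
  -- Both sides are values of functions in the Hardy space that `Θ₂` maps to `Φ j Θ₁ x`.
  have h := hΘ₂.eq_of_mul_eq (f := V₂ j (const F (τ x)))
    (g := diag (τ : E →L[ℂ] F) (V₁ j (const E x))) fun z => by
      rw [hV₂, diag_apply, hV₁, const_apply, const_apply]
      have h1 := DFunLike.congr_fun (hint₁ j z) x
      have h2 := DFunLike.congr_fun (hint₂ j z) (τ x)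
      rw [hτ] at h1
      exact h2.symm.trans h1
  have h' := DFunLike.congr_fun h z
  rw [hV₂, diag_apply, hV₁, const_apply, const_apply] at h'
  exact h'

end Representation

end HardyModel

theorem theorem4p1 {W : Type u} [NormedAddCommGroup W] [InnerProductSpace ℂ W] [CompleteSpace W]
    {n : ℕ} (hn : 1 ≤ n) (Φ : Fin n → ℂ → W →L[ℂ] W) (hΦ : HardyModel.IsModelNIsometry Φ)
    (S : Submodule ℂ (HardyModel.HardySpace W))
    (hS : IsClosed (S : Set (HardyModel.HardySpace W))) :
    (HardyModel.IsJointlyInvariant Φ S ↔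
      ∃ (W' : Type u) (_ : NormedAddCommGroup W') (_ : InnerProductSpace ℂ W')
        (_ : CompleteSpace W') (Θ : ℂ → W' →L[ℂ] W) (Ψ : Fin n → ℂ → W' →L[ℂ] W'),
        HardyModel.IsRepresentation Φ S Θ Ψ) ∧
    (∀ (W₁ : Type v) [NormedAddCommGroup W₁] [InnerProductSpace ℂ W₁] [CompleteSpace W₁]
      (W₂ : Type w) [NormedAddCommGroup W₂] [InnerProductSpace ℂ W₂] [CompleteSpace W₂]
      (Θ₁ : ℂ → W₁ →L[ℂ] W) (Ψ₁ : Fin n → ℂ → W₁ →L[ℂ] W₁)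
      (Θ₂ : ℂ → W₂ →L[ℂ] W) (Ψ₂ : Fin n → ℂ → W₂ →L[ℂ] W₂),
      HardyModel.IsRepresentation Φ S Θ₁ Ψ₁ → HardyModel.IsRepresentation Φ S Θ₂ Ψ₂ →
      ∃ τ : W₁ ≃ₗᵢ[ℂ] W₂,
        (∀ z : Complex.UnitDisc, Θ₁ z = Θ₂ z ∘L (τ : W₁ →L[ℂ] W₂)) ∧
        ∀ j, ∀ z : Complex.UnitDisc,
          Ψ₂ j z ∘L (τ : W₁ →L[ℂ] W₂) = (τ : W₁ →L[ℂ] W₂) ∘L Ψ₁ j z) := by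
  exact ⟨⟨fun h => h.exists_isRepresentation hΦ hS,
      fun ⟨_, _, _, _, _, _, h⟩ => h.isJointlyInvariant⟩,
    fun _ _ _ _ _ _ _ _ _ _ _ _ h₁ h₂ => h₁.exists_unitary h₂⟩
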